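/- Let $a<b<c<d$ be natural numbers with $\gcd(a,b,c,d)=1$ such that every number of the form $a^pb^qc^ld^f$ ($p,q,l,f\in\mathbb N_0$) has only one such representation (for example, $a\ge 2$ and $a,b,c,d$ pairwise coprime). Put $$N_{a,b,c,d}(x)=\#\{(p,q,l,f)\in\mathbb N_0^4: a^pb^qc^ld^f\le x\},\qquad S_{a,b,c,d}=\{a^pb^qc^ld^f:p,q,l,f\in\mathbb N_0\},$$ let $\chi_{S_{a,b,c,d}}$ be the characteristic function of $S_{a,b,c,d}$, and let $B_1^*(\{t\})=\{t\}-\tfrac12$ for $t\notin\mathbb Z$ and $B_1^*(\{t\})=0$ for $t\in\mathbb Z$, where $\{t\}$ is the fractional part. Write $L_u=\log u$, and let $u,v,w,z$ denote distinct elements of $\{a,b,c,d\}$. For real $x\ge1$, $X=\log x$ and $R>0$ define the partial sums $$C^{(1)}_{u;v}(R)=\sum_{k=1}^{\lfloor R L_u\rfloor}\frac{\cos\left(\frac{\pi kL_v}{L_u}\right)\cos\left(2\pi k\frac{X}{L_u}\right)}{k\,\sin\left(\frac{\pi kL_v}{L_u}\right)},$$ $$C^{(2)}_{u;v,w}(R)=\sum_{k=1}^{\lfloor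 R L_u\rfloor}\frac{\cos\left(\frac{\pi kL_v}{L_u}\right)\cos\left(\frac{\pi kL_w}{L_u}\right)\sin\left(2\pi k\frac{X}{L_u}\right)}{k\,\sin\left(\frac{\pi kL_v}{L_u}\right)\sin\left(\frac{\pi kL_w}{L_u}\right)},$$ $$C^{(3)}_{u;v,w,z}(R)=\sum_{k=1}^{\lfloor R L_u\rfloor}\frac{\cos\left(\frac{\pi kL_v}{L_u}\right)\cos\left(\frac{\pi kL_w}{L_u}\right)\cos\left(\frac{\pi kL_z}{L_u}\right)\cos\left(2\pi k\frac{X}{L_u}\right)}{k\,\sin\left(\frac{\pi kL_v}{L_u}\right)\sin\left(\frac{\pi kL_w}{L_u}\right)\sin\left(\frac{\pi kL_z}{L_u}\right)}.$$ Then there is a sequence $R_j\to\infty$, not depending on $x$, such that for every real $x\ge1$ the following limits exist for all pairs $\{u,v\}$ and all triples $\{u,v,w\}$ in $\{a,b,c,d\}$: $$P_{uv}=\lim_{j\to\infty}\left(C^{(1)}_{u;v}(R_j)+C^{(1)}_{v;u}(R_j)\right),\qquad T_{uvw}=\lim_{j\to\infty}\left(C^{(2)}_{u;v,w}(R_j)+C^{(2)}_{v;u,w}(R_j)+C^{(2)}_{w;u,v}(R_j)\right),$$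 $$Q=\lim_{j\to\infty}\left(C^{(3)}_{a;b,c,d}(R_j)+C^{(3)}_{b;a,c,d}(R_j)+C^{(3)}_{c;a,b,d}(R_j)+C^{(3)}_{d;a,b,c}(R_j)\right),$$ and $$N_{a,b,c,d}(x)=M(X)-\frac18\sum_{u}B_1^*\left(\left\{\frac{X}{L_u}\right\}\right)-\frac1{8\pi}\sum_{\{u,v\}}P_{uv}-\frac1{8\pi}\sum_{\{u,v,w\}}T_{uvw}+\frac1{8\pi}Q+\frac12\chi_{S_{a,b,c,d}}(x).$$ Here the sums run over all elements, all two-element subsets and all three-element subsets of $\{a,b,c,d\}$, and $M$ is the quartic polynomial $$\begin{aligned}M(X)={}&\frac{X^4}{24L_aL_bL_cL_d}+\sum_{\{u,v,w\}}\frac{X^3}{12L_uL_vL_w}+\sum_{u}\frac{L_uX^2}{24L_vL_wL_z}+\sum_{\{u,v\}}\frac{X^2}{8L_uL_v}+\sum_u\frac{X}{8L_u}+\sum_{u}\ \sum_{\{v,w\}\not\ni u}\frac{L_uX}{24L_vL_w}\\&+\frac1{16}+\sum_{u\ne v}\frac{L_u}{48L_v}+\sum_{\{u,v\}}\frac{L_uL_v}{144L_wL_z}-\sum_u\frac{L_u^3}{720L_vL_wL_z},\end{aligned}$$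 where in the sum over $u\neq v$ both orders are counted, and in each summand those of the letters $v,w,z$ that are not summation indices denote the remaining elements of $\{a,b,c,d\}$. In particular, the same statement holds for $(a,b,c,d)=(2,3,5,7)$, that is, for the counting function $N_{2,3,5,7}(x)$ of the $7$-smooth numbers. -/

import Mathlib

open Filter Topology

namespace SmoothCount

noncomputable section

/-- `N_{a,b,c,d}(x)`: the number of exponent vectors `(p, q, l, f)` of natural numbers with
`a ^ p * b ^ q * c ^ l * d ^ f ≤ x`. -/
def count (a b c d : ℕ) (x : ℝ) : ℕ :=
  Set.ncard {e : ℕ × ℕ × ℕ × ℕ |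
    ((a ^ e.1 * b ^ e.2.1 * c ^ e.2.2.1 * d ^ e.2.2.2 : ℕ) : ℝ) ≤ x}

/-- `S_{a,b,c,d}`, viewed as a set of real numbers. -/
def smoothSet (a b c d : ℕ) : Set ℝ :=
  {y | ∃ p q l f : ℕ, y = ((a ^ p * b ^ q * c ^ l * d ^ f : ℕ) : ℝ)}

/-- The characteristic function `χ` of `S_{a,b,c,d}`. -/
def chi (a b c d : ℕ) (x : ℝ) : ℝ :=
  (smoothSet a b c d).indicator (fun _ => 1) x

/-- Every number of the form `a ^ p * b ^ q * c ^ l * d ^ f` has only one such representation. -/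
def UniqueRep (a b c d : ℕ) : Prop :=
  Function.Injective (fun e : ℕ × ℕ × ℕ × ℕ =>
    a ^ e.1 * b ^ e.2.1 * c ^ e.2.2.1 * d ^ e.2.2.2)

/-- `B₁*({t})`: it is `{t} - 1/2` if `t` is not an integer and `0` if `t` is an integer. -/
def bernoulliOneStar (t : ℝ) : ℝ :=
  if Int.fract t = 0 then 0 else Int.fract t - 1 / 2

/-- The quartic polynomial in `X = log x`, with `A, B, C, D` the logarithms of the four bases. -/
def mainPoly (A B C D X : ℝ) : ℝ :=
  X ^ 4 / (24 * A * B * C * D)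
  + X ^ 3 / (12 * A * B * C) + X ^ 3 / (12 * A * B * D)
  + X ^ 3 / (12 * A * C * D) + X ^ 3 / (12 * B * C * D)
  + A * X ^ 2 / (24 * B * C * D) + B * X ^ 2 / (24 * A * C * D)
  + C * X ^ 2 / (24 * A * B * D) + D * X ^ 2 / (24 * A * B * C)
  + X ^ 2 / (8 * A * B) + X ^ 2 / (8 * A * C) + X ^ 2 / (8 * A * D)
  + X ^ 2 / (8 * B * C) + X ^ 2 / (8 * B * D) + X ^ 2 / (8 * C * D)
  + X / (8 * A) + X / (8 * B) + X / (8 * C) + X / (8 * D)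
  + A * X / (24 * B * C) + A * X / (24 * B * D) + A * X / (24 * C * D)
  + B * X / (24 * A * C) + B * X / (24 * A * D) + B * X / (24 * C * D)
  + C * X / (24 * A * B) + C * X / (24 * A * D) + C * X / (24 * B * D)
  + D * X / (24 * A * B) + D * X / (24 * A * C) + D * X / (24 * B * C)
  + 1 / 16
  + A / (48 * B) + A / (48 * C) + A / (48 * D)
  + B / (48 * A) + B / (48 * C) + B / (48 * D)
  + C / (48 * A) + C / (48 * B) + C / (48 * D)
  + D / (48 * A) + D / (48 * B) + D / (48 * C)
  + A * B / (144 * C * D) + A * C / (144 * B * D) + A * D / (144 * B * C)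
  + B * C / (144 * A * D) + B * D / (144 * A * C) + C * D / (144 * A * B)
  - A ^ 3 / (720 * B * C * D) - B ^ 3 / (720 * A * C * D)
  - C ^ 3 / (720 * A * B * D) - D ^ 3 / (720 * A * B * C)

/-- Partial sum over `1 ≤ k ≤ ⌊R log a⌋` of the series with base `a` and one cotangent factor
`cot (π k log b / log a)`. -/
def oneCot (x R : ℝ) (a b : ℕ) : ℝ :=
  ∑ k ∈ Finset.Icc 1 ⌊R * Real.log a⌋₊,
    Real.cos (Real.pi * k * Real.log b / Real.log a) *
      Real.cos (2 * Real.pi * k * (Real.log x / Real.log a)) /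
    (k * Real.sin (Real.pi * k * Real.log b / Real.log a))

/-- Partial sum over `1 ≤ k ≤ ⌊R log a⌋` of the series with base `a` and two cotangent factors. -/
def twoCot (x R : ℝ) (a b c : ℕ) : ℝ :=
  ∑ k ∈ Finset.Icc 1 ⌊R * Real.log a⌋₊,
    Real.cos (Real.pi * k * Real.log b / Real.log a) *
      Real.cos (Real.pi * k * Real.log c / Real.log a) *
      Real.sin (2 * Real.pi * k * (Real.log x / Real.log a)) /
    (k * Real.sin (Real.pi * k * Real.log b / Real.log a) *
      Real.sin (Real.pi * k * Real.log c / Real.log a))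

/-- Partial sum over `1 ≤ k ≤ ⌊R log a⌋` of the series with base `a` and three cotangent
factors. -/
def threeCot (x R : ℝ) (a b c d : ℕ) : ℝ :=
  ∑ k ∈ Finset.Icc 1 ⌊R * Real.log a⌋₊,
    Real.cos (Real.pi * k * Real.log b / Real.log a) *
      Real.cos (Real.pi * k * Real.log c / Real.log a) *
      Real.cos (Real.pi * k * Real.log d / Real.log a) *
      Real.cos (2 * Real.pi * k * (Real.log x / Real.log a)) /
    (k * Real.sin (Real.pi * k * Real.log b / Real.log a) *
      Real.sin (Real.pi * k * Real.log c / Real.log a) *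
      Real.sin (Real.pi * k * Real.log d / Real.log a))

/-- `P` is the value of the two one-cotangent series belonging to the pair `{a, b}`, summed with
the common cutoffs `⌊R log a⌋`, `⌊R log b⌋`, as `R → ∞` along the sequence `R`. -/
def HasPairSum (R : ℕ → ℝ) (x : ℝ) (a b : ℕ) (P : ℝ) : Prop :=
  Tendsto (fun j => oneCot x (R j) a b + oneCot x (R j) b a) atTop (𝓝 P)

/-- The same for the three two-cotangent series belonging to `{a, b, c}`. -/
def HasTripleSum (R : ℕ → ℝ) (x : ℝ) (a b c : ℕ) (T : ℝ) : Prop :=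
  Tendsto (fun j => twoCot x (R j) a b c + twoCot x (R j) b a c + twoCot x (R j) c a b)
    atTop (𝓝 T)

/-- The same for the four three-cotangent series belonging to `{a, b, c, d}`. -/
def HasQuadSum (R : ℕ → ℝ) (x : ℝ) (a b c d : ℕ) (Q : ℝ) : Prop :=
  Tendsto (fun j => threeCot x (R j) a b c d + threeCot x (R j) b a c d
    + threeCot x (R j) c a b d + threeCot x (R j) d a b c) atTop (𝓝 Q)

/-- The cotangent formula for `N_{a,b,c,d}(x)`: the series converge along `R`, and the formula
holds with their values. -/
def CotFormula (a b c d : ℕ) (R : ℕ → ℝ) (x : ℝ) : Prop :=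
  ∃ Pab Pac Pad Pbc Pbd Pcd Tabc Tabd Tacd Tbcd Q : ℝ,
    HasPairSum R x a b Pab ∧ HasPairSum R x a c Pac ∧ HasPairSum R x a d Pad ∧
    HasPairSum R x b c Pbc ∧ HasPairSum R x b d Pbd ∧ HasPairSum R x c d Pcd ∧
    HasTripleSum R x a b c Tabc ∧ HasTripleSum R x a b d Tabd ∧
    HasTripleSum R x a c d Tacd ∧ HasTripleSum R x b c d Tbcd ∧
    HasQuadSum R x a b c d Q ∧
    (count a b c d x : ℝ) =
      mainPoly (Real.log a) (Real.log b) (Real.log c) (Real.log d) (Real.log x)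
      - 1 / 8 * bernoulliOneStar (Real.log x / Real.log a)
      - 1 / 8 * bernoulliOneStar (Real.log x / Real.log b)
      - 1 / 8 * bernoulliOneStar (Real.log x / Real.log c)
      - 1 / 8 * bernoulliOneStar (Real.log x / Real.log d)
      - 1 / (8 * Real.pi) * (Pab + Pac + Pad + Pbc + Pbd + Pcd)
      - 1 / (8 * Real.pi) * (Tabc + Tabd + Tacd + Tbcd)
      + 1 / (8 * Real.pi) * Q
      + 1 / 2 * chi a b c d x

end

end SmoothCount

/-
The count of exponent vectors is, up to the boundary term `χ / 2`, the Perron integral of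
`x ^ s / s * ∏ (1 - n ^ (-s))⁻¹` over the four bases `n`. Moving the line of integration to the far
left, along horizontal cutoffs that stay away from all poles, turns it into a sum of residues. At
`s = 0` the product of Todd series gives the quartic polynomial. Multiplicative independence makes
the other poles `2πik / log u` simple, and there each remaining factor equals
`(1 - i cot (πk log v / log u)) / 2`; expanding the product groups the residues by the set
consisting of `u` and the bases that contribute a cotangent. The expansion gives convergence only of
the sum over all subsets of the set of bases. But the same argument applies to every subset, so
induction on the set of bases isolates the contribution of each subset.
-/

namespace SmoothCount

open Complex

open scoped Real Polynomial PowerSeries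

/-! ### Residues on rectangles -/

section Rectangle

/-- The integral of `f` over the boundary of `[x₀, x₁] × [y₀, y₁]`, counterclockwise. -/
noncomputable def rectIntegral (f : ℂ → ℂ) (x₀ x₁ y₀ y₁ : ℝ) : ℂ :=
  (∫ x : ℝ in x₀..x₁, f (x + y₀ * I)) - (∫ x : ℝ in x₀..x₁, f (x + y₁ * I))
    + I * (∫ y : ℝ in y₀..y₁, f (x₁ + y * I)) - I * ∫ y : ℝ in y₀..y₁, f (x₀ + y * I)

/-- The boundary of the rectangle `[x₀, x₁] × [y₀, y₁]`. -/
def rectBoundary (x₀ x₁ y₀ y₁ : ℝ) : Set ℂ :=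
  (Set.Icc x₀ x₁ ×ℂ Set.Icc y₀ y₁) \ (Set.Ioo x₀ x₁ ×ℂ Set.Ioo y₀ y₁)

variable {x₀ x₁ y₀ y₁ : ℝ} {f g : ℂ → ℂ} {ρ : ℂ}

lemma mem_rectBoundary {x y : ℝ} (hx : x ∈ Set.Icc x₀ x₁) (hy : y ∈ Set.Icc y₀ y₁)
    (h : x = x₀ ∨ x = x₁ ∨ y = y₀ ∨ y = y₁) : (x + y * I : ℂ) ∈ rectBoundary x₀ x₁ y₀ y₁ := by
  refine ⟨by simpa [mem_reProdIm] using ⟨hx, hy⟩, fun h' => ?_⟩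
  obtain ⟨⟨h₁, h₂⟩, h₃, h₄⟩ : (x₀ < x ∧ x < x₁) ∧ y₀ < y ∧ y < y₁ := by
    simpa [mem_reProdIm] using h'
  rcases h with h | h | h | h <;> linarith

lemma horizontal_mem_rectBoundary (hy : y₀ ≤ y₁) {x y : ℝ} (hx : x ∈ Set.Icc x₀ x₁)
    (h : y = y₀ ∨ y = y₁) : (x + y * I : ℂ) ∈ rectBoundary x₀ x₁ y₀ y₁ :=
  mem_rectBoundary hx (by rcases h with rfl | rfl <;> simp [hy]) (by tauto)

lemma vertical_mem_rectBoundary (hx : x₀ ≤ x₁) {x y : ℝ} (hy : y ∈ Set.Icc y₀ y₁)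
    (h : x = x₀ ∨ x = x₁) : (x + y * I : ℂ) ∈ rectBoundary x₀ x₁ y₀ y₁ :=
  mem_rectBoundary (by rcases h with rfl | rfl <;> simp [hx]) hy (by tauto)

lemma sub_ne_zero_of_mem_rectBoundary (hρ : ρ ∈ Set.Ioo x₀ x₁ ×ℂ Set.Ioo y₀ y₁) {s : ℂ}
    (hs : s ∈ rectBoundary x₀ x₁ y₀ y₁) : s - ρ ≠ 0 :=
  sub_ne_zero.2 fun h => hs.2 (h ▸ hρ)

lemma continuousOn_sub_zpow (hρ : ρ ∈ Set.Ioo x₀ x₁ ×ℂ Set.Ioo y₀ y₁) (m : ℤ) :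
    ContinuousOn (fun s => (s - ρ) ^ m) (rectBoundary x₀ x₁ y₀ y₁) :=
  ContinuousOn.zpow₀ (by fun_prop) m fun _ hs => .inl (sub_ne_zero_of_mem_rectBoundary hρ hs)

lemma rectIntegral_congr (hx : x₀ ≤ x₁) (hy : y₀ ≤ y₁)
    (h : Set.EqOn f g (rectBoundary x₀ x₁ y₀ y₁)) :
    rectIntegral f x₀ x₁ y₀ y₁ = rectIntegral g x₀ x₁ y₀ y₁ := by
  have horizontal : ∀ y, y = y₀ ∨ y = y₁ →
      ∫ x : ℝ in x₀..x₁, f (x + y * I) = ∫ x : ℝ in x₀..x₁, g (x + y * I) := fun y hy' =>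
    intervalIntegral.integral_congr fun x hx' =>
      h (horizontal_mem_rectBoundary hy (Set.uIcc_of_le hx ▸ hx') hy')
  have vertical : ∀ x, x = x₀ ∨ x = x₁ →
      ∫ y : ℝ in y₀..y₁, f (x + y * I) = ∫ y : ℝ in y₀..y₁, g (x + y * I) := fun x hx' =>
    intervalIntegral.integral_congr fun y hy' =>
      h (vertical_mem_rectBoundary hx (Set.uIcc_of_le hy ▸ hy') hx')
  simp only [rectIntegral, horizontal _ (.inl rfl), horizontal _ (.inr rfl),
    vertical _ (.inl rfl), vertical _ (.inr rfl)]

lemma intervalIntegrable_horizontal (hx : x₀ ≤ x₁) (hy : y₀ ≤ y₁)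
    (hf : ContinuousOn f (rectBoundary x₀ x₁ y₀ y₁)) {y : ℝ} (h : y = y₀ ∨ y = y₁) :
    IntervalIntegrable (fun x : ℝ => f (x + y * I)) MeasureTheory.volume x₀ x₁ :=
  ContinuousOn.intervalIntegrable <| hf.comp (by fun_prop) fun _ hx' =>
    horizontal_mem_rectBoundary hy (Set.uIcc_of_le hx ▸ hx') h

lemma intervalIntegrable_vertical (hx : x₀ ≤ x₁) (hy : y₀ ≤ y₁)
    (hf : ContinuousOn f (rectBoundary x₀ x₁ y₀ y₁)) {x : ℝ} (h : x = x₀ ∨ x = x₁) :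
    IntervalIntegrable (fun y : ℝ => f (x + y * I)) MeasureTheory.volume y₀ y₁ :=
  ContinuousOn.intervalIntegrable <| hf.comp (by fun_prop) fun _ hy' =>
    vertical_mem_rectBoundary hx (Set.uIcc_of_le hy ▸ hy') h

lemma rectIntegral_add (hx : x₀ ≤ x₁) (hy : y₀ ≤ y₁)
    (hf : ContinuousOn f (rectBoundary x₀ x₁ y₀ y₁))
    (hg : ContinuousOn g (rectBoundary x₀ x₁ y₀ y₁)) :
    rectIntegral (fun s => f s + g s) x₀ x₁ y₀ y₁ =
      rectIntegral f x₀ x₁ y₀ y₁ + rectIntegral g x₀ x₁ y₀ y₁ := by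
  have horizontal := fun y (h : y = y₀ ∨ y = y₁) => intervalIntegral.integral_add
    (intervalIntegrable_horizontal hx hy hf h) (intervalIntegrable_horizontal hx hy hg h)
  have vertical := fun x (h : x = x₀ ∨ x = x₁) => intervalIntegral.integral_add
    (intervalIntegrable_vertical hx hy hf h) (intervalIntegrable_vertical hx hy hg h)
  rw [rectIntegral, horizontal _ (.inl rfl), horizontal _ (.inr rfl), vertical _ (.inl rfl),
    vertical _ (.inr rfl), rectIntegral, rectIntegral]
  ring

lemma rectIntegral_const_mul (c : ℂ) (f : ℂ → ℂ) :
    rectIntegral (fun s => c * f s) x₀ x₁ y₀ y₁ = c * rectIntegral f x₀ x₁ y₀ y₁ := by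
  simp only [rectIntegral, intervalIntegral.integral_const_mul]
  ring

lemma rectIntegral_finset_sum (hx : x₀ ≤ x₁) (hy : y₀ ≤ y₁) {κ : Type*} (J : Finset κ)
    {F : κ → ℂ → ℂ} (hF : ∀ i ∈ J, ContinuousOn (F i) (rectBoundary x₀ x₁ y₀ y₁)) :
    rectIntegral (fun s => ∑ i ∈ J, F i s) x₀ x₁ y₀ y₁ =
      ∑ i ∈ J, rectIntegral (F i) x₀ x₁ y₀ y₁ := by
  classical
  induction J using Finset.induction_on with
  | empty => simp [rectIntegral]
  | insert i J hi ih =>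
    rw [Finset.forall_mem_insert] at hF
    simp only [Finset.sum_insert hi]
    rw [rectIntegral_add hx hy hF.1 (continuousOn_finsetSum J hF.2), ih hF.2]

lemma integral_horizontal_of_hasDerivAt {F : ℂ → ℂ} {a b y : ℝ} (hab : a ≤ b)
    (h : ∀ x ∈ Set.Icc a b, HasDerivAt F (f (x + y * I)) (x + y * I : ℂ))
    (hf : ContinuousOn (fun x : ℝ => f (x + y * I)) (Set.Icc a b)) :
    ∫ x : ℝ in a..b, f (x + y * I) = F (b + y * I) - F (a + y * I) := by
  rw [← Set.uIcc_of_le hab] at h hf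
  refine intervalIntegral.integral_eq_sub_of_hasDerivAt
    (f := fun x : ℝ => F (x + y * I)) (fun x hx => ?_) hf.intervalIntegrable
  have hline : HasDerivAt (fun x : ℝ => (x + y * I : ℂ)) 1 x :=
    (ofRealCLM.hasDerivAt (x := x)).add_const _
  exact ((h x hx).comp x hline).congr_deriv (mul_one _)

lemma integral_vertical_of_hasDerivAt {F : ℂ → ℂ} {a b x : ℝ} (hab : a ≤ b)
    (h : ∀ y ∈ Set.Icc a b, HasDerivAt F (f (x + y * I)) (x + y * I : ℂ))
    (hf : ContinuousOn (fun y : ℝ => f (x + y * I)) (Set.Icc a b)) :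
    I * ∫ y : ℝ in a..b, f (x + y * I) = F (x + b * I) - F (x + a * I) := by
  rw [← Set.uIcc_of_le hab] at h hf
  rw [← intervalIntegral.integral_const_mul]
  refine intervalIntegral.integral_eq_sub_of_hasDerivAt
    (f := fun y : ℝ => F (x + y * I)) (fun y hy => ?_)
    (continuousOn_const.mul hf).intervalIntegrable
  have hline : HasDerivAt (fun y : ℝ => (x + y * I : ℂ)) I y := by
    simpa using ((ofRealCLM.hasDerivAt (x := y)).mul_const I).const_add (x : ℂ)
  exact ((h y hy).comp y hline).congr_deriv (mul_comm _ _)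

lemma rectIntegral_of_hasDerivAt (hx : x₀ ≤ x₁) (hy : y₀ ≤ y₁) {F : ℂ → ℂ}
    (hF : ∀ s ∈ rectBoundary x₀ x₁ y₀ y₁, HasDerivAt F (f s) s)
    (hf : ContinuousOn f (rectBoundary x₀ x₁ y₀ y₁)) : rectIntegral f x₀ x₁ y₀ y₁ = 0 := by
  have horizontal : ∀ y, y = y₀ ∨ y = y₁ →
      ∫ x : ℝ in x₀..x₁, f (x + y * I) = F (x₁ + y * I) - F (x₀ + y * I) := fun y hy' =>
    integral_horizontal_of_hasDerivAt hx (fun x h => hF _ (horizontal_mem_rectBoundary hy h hy'))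
      (hf.comp (by fun_prop) fun x h => horizontal_mem_rectBoundary hy h hy')
  have vertical : ∀ x, x = x₀ ∨ x = x₁ →
      I * ∫ y : ℝ in y₀..y₁, f (x + y * I) = F (x + y₁ * I) - F (x + y₀ * I) := fun x hx' =>
    integral_vertical_of_hasDerivAt hy (fun y h => hF _ (vertical_mem_rectBoundary hx h hx'))
      (hf.comp (by fun_prop) fun y h => vertical_mem_rectBoundary hx h hx')
  rw [rectIntegral, horizontal _ (.inl rfl), horizontal _ (.inr rfl), vertical _ (.inl rfl),
    vertical _ (.inr rfl)]
  ring

lemma rectIntegral_sub_zpow (hρ : ρ ∈ Set.Ioo x₀ x₁ ×ℂ Set.Ioo y₀ y₁) {m : ℤ} (hm : m ≠ -1) :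
    rectIntegral (fun s => (s - ρ) ^ m) x₀ x₁ y₀ y₁ = 0 := by
  obtain ⟨hre, him⟩ := mem_reProdIm.1 hρ
  have hm' : (m + 1 : ℂ) ≠ 0 := by exact_mod_cast fun h => hm (by lia)
  refine rectIntegral_of_hasDerivAt (hre.1.trans hre.2).le (him.1.trans him.2).le
    (F := fun s => (s - ρ) ^ (m + 1) / (m + 1)) (fun s hs => ?_) (continuousOn_sub_zpow hρ m)
  have hpow := (hasDerivAt_zpow (m + 1) (s - ρ)
    (.inl (sub_ne_zero_of_mem_rectBoundary hρ hs))).comp_sub_const s ρ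
  refine (hpow.div_const (m + 1 : ℂ)).congr_deriv ?_
  rw [add_sub_cancel_right, Int.cast_add, Int.cast_one, mul_div_cancel_left₀ _ hm']

lemma log_sub_log_neg_of_im_pos {z : ℂ} (hz : 0 < z.im) : log z - log (-z) = π * I := by
  rw [log, log, norm_neg, arg_neg_eq_arg_sub_pi_of_im_pos hz]
  push_cast; ring

lemma log_sub_log_neg_of_im_neg {z : ℂ} (hz : z.im < 0) : log z - log (-z) = -(π * I) := by
  rw [log, log, norm_neg, arg_neg_eq_arg_add_pi_of_im_neg hz]
  push_cast; ring

-- `log (s - ρ)` is a primitive on three of the sides and `log (-(s - ρ))` on the left one; the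
-- two branches differ by `± π i` at the endpoints of the left side.
lemma rectIntegral_inv_sub (hρ : ρ ∈ Set.Ioo x₀ x₁ ×ℂ Set.Ioo y₀ y₁) :
    rectIntegral (fun s => (s - ρ)⁻¹) x₀ x₁ y₀ y₁ = 2 * π * I := by
  obtain ⟨hre, him⟩ := mem_reProdIm.1 hρ
  have hx : x₀ ≤ x₁ := (hre.1.trans hre.2).le
  have hy : y₀ ≤ y₁ := (him.1.trans him.2).le
  have hc : ContinuousOn (fun s => (s - ρ)⁻¹) (rectBoundary x₀ x₁ y₀ y₁) := by
    simpa using continuousOn_sub_zpow hρ (-1)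
  have hlog : ∀ s, s - ρ ∈ slitPlane → HasDerivAt (fun s => log (s - ρ)) (s - ρ)⁻¹ s :=
    fun s hs => by simpa using ((hasDerivAt_id s).sub_const ρ).clog hs
  have hlog_neg : ∀ s, -(s - ρ) ∈ slitPlane →
      HasDerivAt (fun s => log (-(s - ρ))) (s - ρ)⁻¹ s := fun s hs =>
    (((hasDerivAt_id s).sub_const ρ).neg.clog hs).congr_deriv
      (by rw [Pi.neg_apply, neg_div_neg_eq, one_div, id])
  have horizontal : ∀ y, y = y₀ ∨ y = y₁ → ∫ x : ℝ in x₀..x₁, ((x + y * I : ℂ) - ρ)⁻¹ =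
      log (x₁ + y * I - ρ) - log (x₀ + y * I - ρ) := fun y hy' => by
    refine integral_horizontal_of_hasDerivAt hx (f := fun s => (s - ρ)⁻¹)
      (F := fun s => log (s - ρ)) (fun _ _ => hlog _ (.inr ?_))
      (hc.comp (by fun_prop) fun x h => horizontal_mem_rectBoundary hy h hy')
    rcases hy' with rfl | rfl
    · simpa [sub_eq_zero] using him.1.ne
    · simpa [sub_eq_zero] using him.2.ne'
  have right : I * ∫ y : ℝ in y₀..y₁, ((x₁ + y * I : ℂ) - ρ)⁻¹ =
      log (x₁ + y₁ * I - ρ) - log (x₁ + y₀ * I - ρ) :=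
    integral_vertical_of_hasDerivAt hy (f := fun s => (s - ρ)⁻¹) (F := fun s => log (s - ρ))
      (fun _ _ => hlog _ (.inl (by simpa using hre.2)))
      (hc.comp (by fun_prop) fun y h => vertical_mem_rectBoundary hx h (.inr rfl))
  have left : I * ∫ y : ℝ in y₀..y₁, ((x₀ + y * I : ℂ) - ρ)⁻¹ =
      log (-(x₀ + y₁ * I - ρ)) - log (-(x₀ + y₀ * I - ρ)) :=
    integral_vertical_of_hasDerivAt hy (f := fun s => (s - ρ)⁻¹) (F := fun s => log (-(s - ρ)))
      (fun _ _ => hlog_neg _ (.inl (by simpa using hre.1)))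
      (hc.comp (by fun_prop) fun y h => vertical_mem_rectBoundary hx h (.inl rfl))
  rw [rectIntegral, horizontal _ (.inl rfl), horizontal _ (.inr rfl), left, right]
  linear_combination log_sub_log_neg_of_im_pos (z := x₀ + y₁ * I - ρ) (by simpa using him.2)
    - log_sub_log_neg_of_im_neg (z := x₀ + y₀ * I - ρ) (by simpa using him.1)

/-- The Laurent polynomial `p (s - ρ) / (s - ρ) ^ (n + 1)`, used to split off the singular part of
a function at a pole `ρ` of order at most `n + 1`. -/
noncomputable def laurentPart (p : ℂ[X]) (n : ℕ) (ρ s : ℂ) : ℂ :=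
  p.eval (s - ρ) / (s - ρ) ^ (n + 1)

lemma laurentPart_eq_sum (p : ℂ[X]) (n : ℕ) {s : ℂ} (hs : s - ρ ≠ 0) :
    laurentPart p n ρ s = ∑ i ∈ p.support, p.coeff i * (s - ρ) ^ (i - (n + 1) : ℤ) := by
  rw [laurentPart, Polynomial.eval_eq_sum, Polynomial.sum, Finset.sum_div]
  refine Finset.sum_congr rfl fun i _ => ?_
  rw [zpow_sub₀ hs, mul_div_assoc]
  norm_cast

lemma differentiableAt_laurentPart (p : ℂ[X]) (n : ℕ) {s : ℂ} (hs : s - ρ ≠ 0) :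
    DifferentiableAt ℂ (laurentPart p n ρ) s := by
  have hp : DifferentiableAt ℂ (fun s => p.eval (s - ρ)) s :=
    p.differentiable.differentiableAt.comp s (by fun_prop)
  exact hp.fun_div (by fun_prop) (pow_ne_zero _ hs)

lemma continuousOn_laurentPart (hρ : ρ ∈ Set.Ioo x₀ x₁ ×ℂ Set.Ioo y₀ y₁) (p : ℂ[X]) (n : ℕ) :
    ContinuousOn (laurentPart p n ρ) (rectBoundary x₀ x₁ y₀ y₁) := fun _ hs =>
  (differentiableAt_laurentPart p n
    (sub_ne_zero_of_mem_rectBoundary hρ hs)).continuousAt.continuousWithinAt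

lemma rectIntegral_laurentPart (hρ : ρ ∈ Set.Ioo x₀ x₁ ×ℂ Set.Ioo y₀ y₁) (p : ℂ[X]) (n : ℕ) :
    rectIntegral (laurentPart p n ρ) x₀ x₁ y₀ y₁ = 2 * π * I * p.coeff n := by
  obtain ⟨hre, him⟩ := mem_reProdIm.1 hρ
  have hx : x₀ ≤ x₁ := (hre.1.trans hre.2).le
  have hy : y₀ ≤ y₁ := (him.1.trans him.2).le
  rw [rectIntegral_congr hx hy fun s hs =>
      laurentPart_eq_sum p n (sub_ne_zero_of_mem_rectBoundary hρ hs),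
    rectIntegral_finset_sum hx hy p.support
      (F := fun i s => p.coeff i * (s - ρ) ^ (i - (n + 1) : ℤ))
      fun i _ => continuousOn_const.mul (continuousOn_sub_zpow hρ _)]
  simp only [rectIntegral_const_mul]
  rw [Finset.sum_eq_single n]
  · rw [show ((n : ℤ) - (n + 1)) = -1 by ring]
    simp only [zpow_neg_one, rectIntegral_inv_sub hρ, mul_comm]
  · intro i _ hi
    rw [rectIntegral_sub_zpow hρ (by lia), mul_zero]
  · intro hn
    rw [Polynomial.notMem_support_iff.1 hn, zero_mul]

/-- `f` has at `ρ` an isolated singularity that is at most a pole, with residue `r`: up to a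
function that is `o(1 / (s - ρ))`, it is a Laurent polynomial whose coefficient at `(s - ρ)⁻¹`
is `r`. -/
def HasResidueAt (f : ℂ → ℂ) (ρ r : ℂ) : Prop :=
  ∃ (p : ℂ[X]) (n : ℕ), p.coeff n = r ∧
    Tendsto (fun s => (s - ρ) * (f s - laurentPart p n ρ s)) (𝓝[≠] ρ) (𝓝 0)

lemma hasResidueAt_of_tendsto {r : ℂ} (h : Tendsto (fun s => (s - ρ) * f s) (𝓝[≠] ρ) (𝓝 r)) :
    HasResidueAt f ρ r := by
  refine ⟨Polynomial.C r, 0, by simp, ?_⟩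
  have h₀ := h.sub_const r
  rw [sub_self] at h₀
  refine h₀.congr' ?_
  filter_upwards [self_mem_nhdsWithin] with s hs
  have : s - ρ ≠ 0 := sub_ne_zero.2 hs
  simp only [laurentPart, Polynomial.eval_C, zero_add, pow_one]
  field_simp

lemma differentiableAt_update_limUnder (hf : ∀ᶠ s in 𝓝[≠] ρ, DifferentiableAt ℂ f s)
    (h : Tendsto (fun s => (s - ρ) * f s) (𝓝[≠] ρ) (𝓝 0)) :
    DifferentiableAt ℂ (Function.update f ρ (limUnder (𝓝[≠] ρ) f)) ρ := by
  obtain ⟨V, hV, hρV, hVf⟩ := mem_nhdsWithin.1 hf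
  have hd : DifferentiableOn ℂ f (V \ {ρ}) := fun s hs =>
    (hVf ⟨hs.1, hs.2⟩ : DifferentiableAt ℂ f s).differentiableWithinAt
  have ho : (fun s => f s - f ρ) =o[𝓝[≠] ρ] fun s => (s - ρ)⁻¹ := by
    rw [Asymptotics.isLittleO_iff_tendsto' (by
      filter_upwards [self_mem_nhdsWithin] with s hs h₀
      exact absurd (inv_eq_zero.1 h₀) (sub_ne_zero.2 hs))]
    have hconst : Tendsto (fun s => (s - ρ) * f ρ) (𝓝[≠] ρ) (𝓝 0) :=
      tendsto_nhdsWithin_of_tendsto_nhds (Continuous.tendsto' (by fun_prop) _ _ (by simp))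
    simpa only [div_inv_eq_mul, mul_comm _ (_ - ρ), mul_sub, sub_zero] using h.sub hconst
  exact (differentiableOn_update_limUnder_of_isLittleO (hV.mem_nhds hρV) hd
    ho).differentiableAt (hV.mem_nhds hρV)

variable {κ : Type*} {J : Finset κ} {z : κ → ℂ}

lemma eventually_notMem_image (J : Finset κ) (z : κ → ℂ) (ρ : ℂ) :
    ∀ᶠ s in 𝓝[≠] ρ, s ∉ z '' J := by
  have hclosed : IsClosed (z '' J \ {ρ}) := ((J.finite_toSet.image z).sdiff).isClosed
  filter_upwards [nhdsWithin_le_nhds (hclosed.isOpen_compl.mem_nhds (by simp)),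
    self_mem_nhdsWithin] with s hs hsρ h using hs ⟨h, hsρ⟩

-- Cauchy's theorem, applied to the extension of `f` by its limits over the singularities.
lemma rectIntegral_eq_zero_of_removable (hx : x₀ ≤ x₁) (hy : y₀ ≤ y₁)
    (hz : ∀ i ∈ J, z i ∈ Set.Ioo x₀ x₁ ×ℂ Set.Ioo y₀ y₁)
    (hf : ∀ s ∈ Set.Icc x₀ x₁ ×ℂ Set.Icc y₀ y₁, s ∉ z '' J → DifferentiableAt ℂ f s)
    (h₀ : ∀ i ∈ J, Tendsto (fun s => (s - z i) * f s) (𝓝[≠] z i) (𝓝 0)) :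
    rectIntegral f x₀ x₁ y₀ y₁ = 0 := by
  classical
  let F : ℂ → ℂ := fun s => if s ∈ z '' J then limUnder (𝓝[≠] s) f else f s
  have hFf (s : ℂ) : F =ᶠ[𝓝 s] Function.update f s (F s) := by
    filter_upwards [eventually_nhdsWithin_iff.1 (eventually_notMem_image J z s)] with w hw
    rcases eq_or_ne w s with rfl | hws
    · simp
    · rw [Function.update_of_ne hws]
      exact if_neg (hw hws)
  have hF : ∀ s ∈ Set.Icc x₀ x₁ ×ℂ Set.Icc y₀ y₁, DifferentiableAt ℂ F s := by
    intro s hs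
    refine DifferentiableAt.congr_of_eventuallyEq ?_ (hFf s)
    by_cases h : s ∈ z '' J
    · simp only [F, if_pos h]
      obtain ⟨i, hi, rfl⟩ := h
      refine differentiableAt_update_limUnder ?_ (h₀ i hi)
      filter_upwards [eventually_notMem_image J z (z i), nhdsWithin_le_nhds <|
        (isOpen_Ioo.reProdIm isOpen_Ioo).mem_nhds (hz i hi)] with s hsJ hs
      exact hf s (reProdIm_subset_iff.2
        (Set.prod_mono Set.Ioo_subset_Icc_self Set.Ioo_subset_Icc_self) hs) hsJ
    · simpa only [F, if_neg h, Function.update_eq_self] using hf s hs h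
  have hCauchy := integral_boundary_rect_eq_zero_of_differentiableOn F (x₀ + y₀ * I) (x₁ + y₁ * I)
    fun s hs => (hF s (by
      simpa [Set.uIcc_of_le hx, Set.uIcc_of_le hy] using hs)).differentiableWithinAt
  rw [rectIntegral_congr hx hy (g := F) fun s hs => (if_neg ?_).symm]
  · simpa [rectIntegral] using hCauchy
  · rintro ⟨i, hi, rfl⟩
    exact hs.2 (hz i hi)

lemma tendsto_sub_mul_sum_erase_laurentPart [DecidableEq κ] (hinj : Set.InjOn z J) {i : κ}
    (hi : i ∈ J) (p : κ → ℂ[X]) (n : κ → ℕ) :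
    Tendsto (fun s => (s - z i) * ∑ k ∈ J.erase i, laurentPart (p k) (n k) (z k) s)
      (𝓝[≠] z i) (𝓝 0) := by
  have hcont : ContinuousAt (fun s => (s - z i) *
      ∑ k ∈ J.erase i, laurentPart (p k) (n k) (z k) s) (z i) :=
    DifferentiableAt.continuousAt (𝕜 := ℂ) <| DifferentiableAt.fun_mul (by fun_prop) <|
      DifferentiableAt.fun_sum fun k hk => differentiableAt_laurentPart _ _ <|
        sub_ne_zero.2 fun h => Finset.ne_of_mem_erase hk
          (hinj (Finset.mem_of_mem_erase hk) hi h.symm)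
  simpa using hcont.tendsto.mono_left nhdsWithin_le_nhds

theorem rectIntegral_eq_sum_residues (hx : x₀ ≤ x₁) (hy : y₀ ≤ y₁) {r : κ → ℂ}
    (hinj : Set.InjOn z J) (hz : ∀ i ∈ J, z i ∈ Set.Ioo x₀ x₁ ×ℂ Set.Ioo y₀ y₁)
    (hf : ∀ s ∈ Set.Icc x₀ x₁ ×ℂ Set.Icc y₀ y₁, s ∉ z '' J → DifferentiableAt ℂ f s)
    (hr : ∀ i ∈ J, HasResidueAt f (z i) (r i)) :
    rectIntegral f x₀ x₁ y₀ y₁ = 2 * π * I * ∑ i ∈ J, r i := by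
  classical
  choose! p n hp hlim using hr
  let S : ℂ → ℂ := fun s => ∑ i ∈ J, laurentPart (p i) (n i) (z i) s
  have hS : ContinuousOn S (rectBoundary x₀ x₁ y₀ y₁) := continuousOn_finsetSum J fun i hi =>
    continuousOn_laurentPart (hz i hi) _ _
  have hfc : ContinuousOn f (rectBoundary x₀ x₁ y₀ y₁) := fun s hs =>
    (hf s hs.1 fun ⟨i, hi, h⟩ => hs.2 (h ▸ hz i hi)).continuousAt.continuousWithinAt
  have hsub : rectIntegral (fun s => f s - S s) x₀ x₁ y₀ y₁ = 0 := by
    refine rectIntegral_eq_zero_of_removable hx hy hz (fun s hs hsJ => ?_) fun i hi => ?_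
    · refine (hf s hs hsJ).sub (DifferentiableAt.fun_sum fun i hi =>
        differentiableAt_laurentPart _ _ (sub_ne_zero.2 fun h => hsJ ⟨i, hi, h.symm⟩))
    · rw [← sub_zero (0 : ℂ)]
      refine ((hlim i hi).sub (tendsto_sub_mul_sum_erase_laurentPart hinj hi p n)).congr fun s => ?_
      simp only [S, ← Finset.add_sum_erase J _ hi]
      ring
  calc rectIntegral f x₀ x₁ y₀ y₁
      = rectIntegral (fun s => (f s - S s) + S s) x₀ x₁ y₀ y₁ := by simp only [sub_add_cancel]
    _ = ∑ i ∈ J, rectIntegral (laurentPart (p i) (n i) (z i)) x₀ x₁ y₀ y₁ := by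
      rw [rectIntegral_add hx hy (f := fun s => f s - S s) (hfc.sub hS) hS, hsub, zero_add,
        rectIntegral_finset_sum hx hy J fun i hi => continuousOn_laurentPart (hz i hi) _ _]
    _ = 2 * π * I * ∑ i ∈ J, r i := by
      rw [Finset.mul_sum]
      exact Finset.sum_congr rfl fun i hi => by
        rw [rectIntegral_laurentPart (hz i hi), hp i hi]

end Rectangle

/-! ### Perron's formula -/

section Perron

lemma norm_exp_mul_ofReal (s : ℂ) (Y : ℝ) : ‖exp (s * Y)‖ = Real.exp (s.re * Y) := by
  rw [norm_exp, re_mul_ofReal]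

lemma norm_exp_mul_div_le (Y : ℝ) {s : ℂ} {c : ℝ} (hc : 0 < c) (h : c ≤ ‖s‖) :
    ‖exp (s * Y) / s‖ ≤ Real.exp (s.re * Y) / c := by
  rw [norm_div, norm_exp_mul_ofReal]
  gcongr

lemma norm_integral_horizontal_le {f : ℂ → ℂ} {y B C K : ℝ} (hB : 0 < B) (hK : -K ≤ 1)
    (hf : ∀ σ : ℝ, σ ≤ 1 → ‖f (σ + y * I)‖ ≤ C * Real.exp (B * σ)) :
    ‖∫ σ : ℝ in (-K)..1, f (σ + y * I)‖ ≤ C * Real.exp B / B := by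
  have hC : 0 ≤ C := by simpa using (norm_nonneg _).trans (hf 0 zero_le_one)
  calc ‖∫ σ : ℝ in (-K)..1, f (σ + y * I)‖
      ≤ ∫ σ in (-K)..1, C * Real.exp (B * σ) :=
        intervalIntegral.norm_integral_le_of_norm_le hK (.of_forall fun σ hσ => hf σ hσ.2)
          (Continuous.intervalIntegrable (by fun_prop) _ _)
    _ = C * (Real.exp B - Real.exp (B * -K)) / B := by
        rw [intervalIntegral.integral_const_mul,
          intervalIntegral.integral_comp_mul_left (fun x => Real.exp x) hB.ne', integral_exp,
          smul_eq_mul, mul_one]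
        ring
    _ ≤ C * Real.exp B / B := by
        gcongr
        linarith [Real.exp_pos (B * -K)]

-- The rectangle `[-K, 1] × [-T, T]` is extended to the left; only its horizontal sides contribute
-- in the limit.
lemma norm_integral_vertical_sub_le {f : ℂ → ℂ} {T B C : ℝ} {S : ℂ} {ε : ℝ → ℝ} (hT : 0 < T)
    (hB : 0 < B)
    (hside : ∀ t : ℝ, |t| = T → ∀ σ : ℝ, σ ≤ 1 → ‖f (σ + t * I)‖ ≤ C * Real.exp (B * σ))
    (hleft : ∀ᶠ K : ℝ in atTop, ∀ y ∈ Set.Icc (-T) T, ‖f ((-K : ℝ) + y * I)‖ ≤ ε K)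
    (hε : Tendsto ε atTop (𝓝 0))
    (hf : ∀ᶠ K : ℝ in atTop, rectIntegral f (-K) 1 (-T) T = 2 * π * I * S) :
    ‖(∫ y : ℝ in (-T)..T, f ((1 : ℝ) + y * I)) - 2 * π * S‖ ≤ 2 * (C * Real.exp B / B) := by
  have hbound : ∀ᶠ K : ℝ in atTop,
      ‖(∫ y : ℝ in (-T)..T, f ((1 : ℝ) + y * I)) - 2 * π * S‖ ≤
        2 * (C * Real.exp B / B) + ε K * (2 * T) := by
    filter_upwards [hleft, hf, eventually_ge_atTop 0] with K hK hfK hK₀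
    have bottom := norm_integral_horizontal_le hB (by linarith : -K ≤ 1)
      (hside (-T) (by rw [abs_neg, abs_of_pos hT]))
    have top := norm_integral_horizontal_le hB (by linarith : -K ≤ 1) (hside T (abs_of_pos hT))
    have left : ‖∫ y : ℝ in (-T)..T, f ((-K : ℝ) + y * I)‖ ≤ ε K * (2 * T) := by
      refine (intervalIntegral.norm_integral_le_of_norm_le_const (C := ε K)
        fun y hy => hK y ?_).trans_eq ?_
      · rw [Set.uIoc_of_le (by linarith)] at hy
        exact Set.Ioc_subset_Icc_self hy
      · rw [sub_neg_eq_add, abs_of_pos (by linarith)]; ring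
    set R := ∫ y : ℝ in (-T)..T, f ((1 : ℝ) + y * I)
    have hR : R - 2 * π * S = I * ((∫ x : ℝ in (-K)..1, f (x + (-T : ℝ) * I))
        - ∫ x : ℝ in (-K)..1, f (x + T * I)) + ∫ y : ℝ in (-T)..T, f ((-K : ℝ) + y * I) := by
      rw [rectIntegral] at hfK
      linear_combination (-I) * hfK + (R - 2 * π * S -
        ∫ y : ℝ in (-T)..T, f ((-K : ℝ) + y * I)) * I_mul_I
    rw [hR]
    refine (norm_add_le _ _).trans (add_le_add ?_ left)
    rw [norm_mul, norm_I, one_mul]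
    exact (norm_sub_le _ _).trans (by linarith)
  refine ge_of_tendsto (f := fun K => 2 * (C * Real.exp B / B) + ε K * (2 * T)) ?_ hbound
  simpa using (hε.mul_const (2 * T)).const_add (2 * (C * Real.exp B / B))

/-- The truncated Perron integral `∫ exp (s Y) / s` over the segment from `1 - iT` to `1 + iT`
(divided by `i`), which for large `T` approximates `2π` times a unit step in `Y`. -/
noncomputable def perronKernel (T Y : ℝ) : ℂ :=
  ∫ y : ℝ in (-T)..T, exp (((1 : ℝ) + y * I) * Y) / ((1 : ℝ) + y * I)

/-- The unit step function, normalised to `1 / 2` at the jump, as it arises in Perron's formula. -/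
noncomputable def perronStep (Y : ℝ) : ℝ := if Y < 0 then 0 else if Y = 0 then 1 / 2 else 1

lemma perronStep_nonneg (Y : ℝ) : 0 ≤ perronStep Y := by
  unfold perronStep; split_ifs <;> norm_num

lemma perronStep_le_one (Y : ℝ) : perronStep Y ≤ 1 := by
  unfold perronStep; split_ifs <;> norm_num

lemma tendsto_exp_neg_mul_div {Y : ℝ} (hY : 0 ≤ Y) (c : ℝ) :
    Tendsto (fun K : ℝ => c * Real.exp (-K * Y) / K) atTop (𝓝 0) := by
  have hinv : Tendsto (fun K : ℝ => |c| * K⁻¹) atTop (𝓝 0) := by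
    simpa using tendsto_inv_atTop_zero.const_mul |c|
  refine squeeze_zero_norm' ?_ hinv
  filter_upwards [eventually_gt_atTop 0] with K hK
  have hexp : Real.exp (-K * Y) ≤ 1 := Real.exp_le_one_iff.2 (by nlinarith)
  rw [Real.norm_eq_abs, abs_div, abs_mul, Real.abs_exp, abs_of_pos hK, div_eq_mul_inv]
  gcongr
  exact mul_le_of_le_one_right (abs_nonneg c) hexp

lemma hasResidueAt_exp_mul_div (Y : ℝ) : HasResidueAt (fun s => exp (s * Y) / s) 0 1 := by
  refine hasResidueAt_of_tendsto ?_
  have hcont : Tendsto (fun s : ℂ => exp (s * Y)) (𝓝[≠] 0) (𝓝 1) :=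
    tendsto_nhdsWithin_of_tendsto_nhds (Continuous.tendsto' (by fun_prop) _ _ (by simp))
  refine hcont.congr' ?_
  filter_upwards [self_mem_nhdsWithin] with s hs
  rw [sub_zero, mul_div_cancel₀ _ hs]

lemma norm_perronKernel_sub_le_of_pos {T Y : ℝ} (hT : 0 < T) (hY : 0 < Y) :
    ‖perronKernel T Y - 2 * π‖ ≤ 2 * (T⁻¹ * Real.exp Y / Y) := by
  have h := norm_integral_vertical_sub_le (f := fun s => exp (s * Y) / s) (T := T) (B := Y)
    (C := T⁻¹) (S := 1) (ε := fun K => 1 * Real.exp (-K * Y) / K) hT hY (fun t ht σ _ => ?_) ?_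
    (tendsto_exp_neg_mul_div hY.le 1) ?_
  · simpa [perronKernel] using h
  · refine (norm_exp_mul_div_le Y hT ?_).trans_eq ?_
    · simpa [ht] using abs_im_le_norm (σ + t * I : ℂ)
    · rw [inv_mul_eq_div, mul_comm Y]
      simp
  · filter_upwards [eventually_gt_atTop 0] with K hK y _
    refine (norm_exp_mul_div_le Y hK ?_).trans_eq (by simp)
    simpa [abs_of_pos hK] using abs_re_le_norm ((-K : ℝ) + y * I : ℂ)
  · filter_upwards [eventually_gt_atTop 0] with K hK
    rw [rectIntegral_eq_sum_residues (J := {()}) (z := fun _ => 0) (r := fun _ => 1)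
      (by linarith) (by linarith) (by simp) (by simp [mem_reProdIm, hK, hT])
      (fun s _ hs => ?_) (fun _ _ => hasResidueAt_exp_mul_div Y), Finset.sum_singleton]
    have hs : s ≠ 0 := by simpa using hs
    fun_prop (disch := assumption)

-- Here the line of integration has to be moved to the right, so the integrand is reflected in the
-- line `Re s = 1` first.
lemma norm_perronKernel_le_of_neg {T Y : ℝ} (hT : 0 < T) (hY : Y < 0) :
    ‖perronKernel T Y‖ ≤ 2 * (T⁻¹ * Real.exp Y / (-Y)) := by
  have hreflect : perronKernel T Y =
      ∫ y : ℝ in (-T)..T, exp ((2 - ((1 : ℝ) + y * I)) * Y) / (2 - ((1 : ℝ) + y * I)) := by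
    have h := intervalIntegral.integral_comp_neg (a := -T) (b := T)
      (fun y : ℝ => exp (((1 : ℝ) + y * I) * Y) / ((1 : ℝ) + y * I))
    rw [neg_neg] at h
    rw [perronKernel, ← h]
    refine intervalIntegral.integral_congr fun y _ => ?_
    have : (2 - ((1 : ℝ) + y * I) : ℂ) = (1 : ℝ) + (-y : ℝ) * I := by push_cast; ring
    simp only [this]
  have hexp : T⁻¹ * Real.exp Y = T⁻¹ * Real.exp (2 * Y) * Real.exp (-Y) := by
    rw [mul_assoc, ← Real.exp_add]; ring_nf
  have h := norm_integral_vertical_sub_le (f := fun s => exp ((2 - s) * Y) / (2 - s)) (T := T)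
    (B := -Y) (C := T⁻¹ * Real.exp (2 * Y)) (S := 0)
    (ε := fun K => Real.exp (2 * Y) * Real.exp (-K * -Y) / K) hT (by linarith)
    (fun t ht σ _ => ?_) ?_ (tendsto_exp_neg_mul_div (by linarith) _) ?_
  · rwa [← hreflect, mul_zero, sub_zero, ← hexp] at h
  · refine (norm_exp_mul_div_le Y hT ?_).trans_eq ?_
    · simpa [ht] using abs_im_le_norm (2 - (σ + t * I) : ℂ)
    · rw [mul_assoc, inv_mul_eq_div, ← Real.exp_add]
      simp only [sub_re, re_ofNat, add_re, ofReal_re, re_ofReal_mul, I_re, mul_zero, add_zero]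
      ring_nf
  · filter_upwards [eventually_gt_atTop 0] with K hK y _
    refine (norm_exp_mul_div_le Y hK ?_).trans_eq ?_
    · refine le_trans ?_ (abs_re_le_norm _)
      simpa using le_abs.2 (.inl (by linarith : K ≤ 2 + K))
    · rw [← Real.exp_add]
      simp only [sub_re, re_ofNat, add_re, ofReal_re, re_ofReal_mul, I_re, mul_zero, add_zero]
      ring_nf
  · filter_upwards [eventually_gt_atTop 0] with K hK
    rw [mul_zero]
    refine rectIntegral_eq_zero_of_removable (J := (∅ : Finset Unit)) (z := fun _ => 0)
      (by linarith) (by linarith) (by simp) (fun s hs _ => ?_) (by simp)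
    have hs : 2 - s ≠ 0 := fun h => by
      have := (mem_reProdIm.1 hs).1.2
      rw [← sub_eq_zero.1 h, re_ofNat] at this
      norm_num at this
    fun_prop (disch := assumption)

lemma one_add_ofReal_mul_I_ne_zero (y : ℝ) : ((1 : ℝ) + y * I : ℂ) ≠ 0 :=
  fun h => by simpa using congrArg re h

lemma perronKernel_zero (T : ℝ) : perronKernel T 0 = 2 * Real.arctan T := by
  have hderiv : ∀ y : ℝ, HasDerivAt
      (fun y : ℝ => ((Real.arctan y : ℝ) : ℂ) - I / 2 * ((Real.log (1 + y ^ 2) : ℝ) : ℂ))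
      (exp (((1 : ℝ) + y * I) * (0 : ℝ)) / ((1 : ℝ) + y * I)) y := fun y => by
    have hne : (1 + y ^ 2 : ℝ) ≠ 0 := by positivity
    have hsq : HasDerivAt (fun y : ℝ => 1 + y ^ 2) (2 * y) y := by
      simpa using (hasDerivAt_pow 2 y).const_add 1
    refine ((Real.hasDerivAt_arctan y).ofReal_comp.sub
      ((hsq.log hne).ofReal_comp.const_mul (I / 2))).congr_deriv ?_
    have hne' : (1 + y * I : ℂ) ≠ 0 := mod_cast one_add_ofReal_mul_I_ne_zero y
    have hne'' : (1 + y ^ 2 : ℂ) ≠ 0 := by exact_mod_cast hne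
    push_cast
    rw [mul_zero, exp_zero]
    field_simp
    linear_combination (-(y : ℂ) ^ 2) * I_sq
  rw [perronKernel, intervalIntegral.integral_eq_sub_of_hasDerivAt (fun y _ => hderiv y)]
  · rw [Real.arctan_neg, neg_sq]; push_cast; ring
  · exact (Continuous.div (by fun_prop) (by fun_prop)
      one_add_ofReal_mul_I_ne_zero).intervalIntegrable _ _

lemma tendsto_perronKernel (Y : ℝ) :
    Tendsto (fun T => perronKernel T Y) atTop (𝓝 (2 * π * perronStep Y)) := by
  have hzero (c : ℝ) : Tendsto (fun T : ℝ => 2 * (T⁻¹ * Real.exp Y / c)) atTop (𝓝 0) := by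
    simpa using ((tendsto_inv_atTop_zero.mul_const (Real.exp Y)).div_const c).const_mul 2
  rcases lt_trichotomy Y 0 with h | rfl | h
  · simp only [perronStep, h, if_true, ofReal_zero, mul_zero]
    refine squeeze_zero_norm' ?_ (hzero (-Y))
    filter_upwards [eventually_gt_atTop 0] with T hT using norm_perronKernel_le_of_neg hT h
  · simp only [perronKernel_zero, perronStep, lt_irrefl, if_false, if_true]
    have harctan := ((continuous_ofReal.tendsto _).comp
      (Real.tendsto_arctan_atTop.mono_right nhdsWithin_le_nhds)).const_mul 2
    convert harctan using 2
    · simp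
    · push_cast; ring
  · simp only [perronStep, h.not_gt, h.ne', if_false, ofReal_one, mul_one]
    rw [tendsto_iff_norm_sub_tendsto_zero]
    refine squeeze_zero' (.of_forall fun _ => norm_nonneg _) ?_ (hzero Y)
    filter_upwards [eventually_gt_atTop 0] with T hT using norm_perronKernel_sub_le_of_pos hT h

lemma norm_perronKernel_le_of_le_neg_one {T Y : ℝ} (hT : 1 ≤ T) (hY : Y ≤ -1) :
    ‖perronKernel T Y‖ ≤ 2 * Real.exp Y :=
  calc ‖perronKernel T Y‖ ≤ 2 * (T⁻¹ * Real.exp Y / (-Y)) :=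
        norm_perronKernel_le_of_neg (by linarith) (by linarith)
    _ ≤ 2 * (1 * Real.exp Y / 1) := by
        gcongr
        · exact inv_le_one_of_one_le₀ hT
        · linarith
    _ = 2 * Real.exp Y := by ring

variable {κ : Type*}

lemma finite_setOf_neg_one_lt {Y : κ → ℝ} (hY : Summable fun i => Real.exp (Y i)) :
    {i | -1 < Y i}.Finite := by
  have h := hY.tendsto_cofinite_zero.eventually (gt_mem_nhds (Real.exp_pos (-1)))
  refine (eventually_cofinite.1 h).subset fun i hi => ?_
  simpa using (le_of_lt hi : -1 ≤ Y i)

lemma tendsto_tsum_perronKernel {Y : κ → ℝ} (hY : Summable fun i => Real.exp (Y i)) :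
    Tendsto (fun T => ∑' i, perronKernel T (Y i)) atTop
      (𝓝 (2 * π * (∑' i, perronStep (Y i) : ℝ))) := by
  classical
  rw [ofReal_tsum, ← tsum_mul_left]
  have hfin := finite_setOf_neg_one_lt hY
  refine tendsto_tsum_of_dominated_convergence
    (bound := fun i => 2 * Real.exp (Y i) + if -1 < Y i then 2 * π + 1 else 0)
    ((hY.mul_left 2).add (summable_of_hasFiniteSupport (hfin.subset fun i hi => ?_)))
    (fun i => tendsto_perronKernel _) ?_
  · by_contra h
    exact hi (if_neg h)
  · have hlarge : ∀ᶠ T : ℝ in atTop, ∀ i ∈ {i | -1 < Y i}, ‖perronKernel T (Y i)‖ < 2 * π + 1 := by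
      refine (eventually_all_finite hfin).2 fun i _ =>
        (tendsto_perronKernel (Y i)).norm.eventually (gt_mem_nhds ?_)
      rw [← ofReal_ofNat, ← ofReal_mul, ← ofReal_mul, norm_real, Real.norm_of_nonneg
        (mul_nonneg Real.two_pi_pos.le (perronStep_nonneg _))]
      nlinarith [perronStep_le_one (Y i), Real.pi_pos]
    filter_upwards [hlarge, eventually_ge_atTop 1] with T hlargeT hT i
    split_ifs with h
    · exact (hlargeT i h).le.trans (by linarith [Real.exp_pos (Y i)])
    · rw [add_zero]
      exact norm_perronKernel_le_of_le_neg_one hT (not_lt.1 h)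

/-- `F s = ∑ i, exp (-s λ i)` in the half-plane `Re s > 0`: the general Dirichlet series with all
coefficients equal to one. -/
def IsDirichletSum (lam : κ → ℝ) (F : ℂ → ℂ) : Prop :=
  ∀ s : ℂ, 0 < s.re → HasSum (fun i => exp (-(s * lam i))) (F s)

lemma IsDirichletSum.summable_exp_sub {lam : κ → ℝ} {F : ℂ → ℂ} (h : IsDirichletSum lam F)
    (X : ℝ) : Summable fun i => Real.exp (X - lam i) := by
  have hnorm := (h 1 (by simp)).summable.norm.mul_left (Real.exp X)
  simpa [norm_exp, Real.exp_sub, Real.exp_neg, div_eq_mul_inv] using hnorm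

lemma IsDirichletSum.countable {lam : κ → ℝ} {F : ℂ → ℂ} (h : IsDirichletSum lam F) :
    Countable κ := by
  have hcount := (h.summable_exp_sub 0).countable_support
  rw [Function.support_eq_univ (fun i => (Real.exp_pos _).ne'), Set.countable_univ_iff] at hcount
  exact hcount

lemma IsDirichletSum.integral_eq_tsum_perronKernel {lam : κ → ℝ} {F : ℂ → ℂ}
    (h : IsDirichletSum lam F) (X T : ℝ) :
    ∫ y : ℝ in (-T)..T, exp (((1 : ℝ) + y * I) * X) * F ((1 : ℝ) + y * I) / ((1 : ℝ) + y * I) =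
      ∑' i, perronKernel T (X - lam i) := by
  have := h.countable
  refine ((intervalIntegral.hasSum_integral_of_dominated_convergence
    (fun i _ => Real.exp (X - lam i)) (fun i => ?_) (fun i => .of_forall fun y _ => ?_)
    (.of_forall fun _ _ => h.summable_exp_sub X) intervalIntegrable_const
    (.of_forall fun y _ => ?_)).tsum_eq).symm
  · exact (Continuous.div (by fun_prop) (by fun_prop)
      one_add_ofReal_mul_I_ne_zero).aestronglyMeasurable
  · refine (norm_exp_mul_div_le _ one_pos ?_).trans_eq (by simp)
    simpa using abs_re_le_norm ((1 : ℝ) + y * I : ℂ)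
  · refine (((h ((1 : ℝ) + y * I) (by simp)).mul_left
      (exp (((1 : ℝ) + y * I) * X))).div_const ((1 : ℝ) + y * I)).congr_fun fun i => ?_
    rw [← exp_add]
    push_cast
    ring_nf

theorem IsDirichletSum.tendsto_perron {lam : κ → ℝ} {F : ℂ → ℂ}
    (h : IsDirichletSum lam F) (X : ℝ) :
    Tendsto (fun T : ℝ => ∫ y : ℝ in (-T)..T,
      exp (((1 : ℝ) + y * I) * X) * F ((1 : ℝ) + y * I) / ((1 : ℝ) + y * I)) atTop
      (𝓝 (2 * π * (∑' i, perronStep (X - lam i) : ℝ))) := by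
  simp only [h.integral_eq_tsum_perronKernel]
  exact tendsto_tsum_perronKernel (h.summable_exp_sub X)

end Perron

/-! ### Cutoffs avoiding the poles -/

section Cutoffs

variable {ι : Type*} {L : ι → ℝ} {T : Finset ι}

lemma forall_le_abs_sub_int_or {c w : ℝ} (hc : 0 ≤ c) (hw : 4 * (c * w) ≤ 1) (y : ℝ) :
    (∀ R ∈ Set.Icc y (y + w), ∀ m : ℤ, c * w / 2 ≤ |c * R - m|) ∨
      ∀ R ∈ Set.Icc (y + 2 * w) (y + 3 * w), ∀ m : ℤ, c * w / 2 ≤ |c * R - m| := by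
  by_contra! hcon
  obtain ⟨⟨R₁, hR₁, m₁, h₁⟩, R₂, hR₂, m₂, h₂⟩ := hcon
  rw [abs_lt] at h₁ h₂
  have hlow : c * w ≤ c * (R₂ - R₁) := by gcongr; linarith [hR₁.2, hR₂.1]
  have hupp : c * (R₂ - R₁) ≤ c * (3 * w) := by gcongr; linarith [hR₁.1, hR₂.2]
  have hpos : ((0 : ℤ) : ℝ) < (m₂ - m₁ : ℤ) := by push_cast; linarith
  have hlt : ((m₂ - m₁ : ℤ) : ℝ) < (1 : ℤ) := by push_cast; linarith
  rw [Int.cast_lt] at hpos hlt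
  lia

lemma exists_mem_Icc_forall_le_abs_sub_int (hL : ∀ u ∈ T, 0 < L u) {ℓ : ℝ} (hℓ : 0 < ℓ) :
    ∃ δ > 0, ∀ y : ℝ, ∃ R ∈ Set.Icc y (y + ℓ), ∀ u ∈ T, ∀ m : ℤ, δ ≤ |L u * R - m| := by
  classical
  induction T using Finset.induction generalizing ℓ with
  | empty => exact ⟨1, one_pos, fun y => ⟨y, ⟨le_rfl, by linarith⟩, by simp⟩⟩
  | insert u T _ ih =>
    have hLu : 0 < L u := hL u (Finset.mem_insert_self u T)
    obtain ⟨w, hw, hwℓ, hwL⟩ : ∃ w, 0 < w ∧ 3 * w ≤ ℓ ∧ 4 * (L u * w) ≤ 1 := by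
      refine ⟨min (ℓ / 3) (1 / (4 * L u)), by positivity, ?_, ?_⟩
      · linarith [min_le_left (ℓ / 3) (1 / (4 * L u))]
      · have hmin := min_le_right (ℓ / 3) (1 / (4 * L u))
        rw [le_div_iff₀ (by positivity)] at hmin
        linarith
    obtain ⟨δ, hδ, hT⟩ := ih (fun v hv => hL v (Finset.mem_insert_of_mem hv)) hw
    refine ⟨min δ (L u * w / 2), by positivity, fun y => ?_⟩
    obtain ⟨y', hy', hyℓ, hu⟩ : ∃ y', y ≤ y' ∧ y' + w ≤ y + ℓ ∧
        ∀ R ∈ Set.Icc y' (y' + w), ∀ m : ℤ, L u * w / 2 ≤ |L u * R - m| := by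
      rcases forall_le_abs_sub_int_or hLu.le hwL y with h | h
      · exact ⟨y, le_rfl, by linarith, h⟩
      · refine ⟨y + 2 * w, by linarith, by linarith, ?_⟩
        rwa [show y + 2 * w + w = y + 3 * w by ring]
    obtain ⟨R, hR, hRT⟩ := hT y'
    refine ⟨R, ⟨hy'.trans hR.1, hR.2.trans hyℓ⟩, fun v hv m => ?_⟩
    rcases Finset.mem_insert.1 hv with rfl | hv
    · exact (min_le_right _ _).trans (hu R hR m)
    · exact (min_le_left _ _).trans (hRT v hv m)

lemma le_abs_sin_pi_mul {t δ : ℝ} (h : ∀ m : ℤ, δ ≤ |t - m|) : 2 * δ ≤ |Real.sin (π * t)| := by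
  have hle : |π * (t - round t)| ≤ π / 2 := by
    rw [abs_mul, abs_of_pos Real.pi_pos]
    nlinarith [abs_sub_round t, Real.pi_pos]
  calc 2 * δ ≤ 2 * |t - round t| := by gcongr; exact h _
    _ = 2 / π * |π * (t - round t)| := by
      rw [abs_mul, abs_of_pos Real.pi_pos]
      field_simp
    _ ≤ |Real.sin (π * (t - round t))| := Real.mul_abs_le_abs_sin hle
    _ = |Real.sin (π * t)| := by
      rw [show π * (t - round t) = π * t - round t * π by ring, Real.sin_sub_int_mul_pi, abs_mul,
        abs_neg_one_zpow, one_mul]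

/-- Cutoffs `R j → ∞` for which the horizontal lines `Im s = ± 2π R j` stay uniformly away from the
zeros of all the functions `1 - exp (-s L u)` with `u ∈ T`. -/
def GoodCutoffs (L : ι → ℝ) (T : Finset ι) (R : ℕ → ℝ) : Prop :=
  Tendsto R atTop atTop ∧ ∃ δ > 0, ∀ j, ∀ u ∈ T, δ ≤ |Real.sin (2 * π * R j * L u)|

lemma GoodCutoffs.mono {R : ℕ → ℝ} (h : GoodCutoffs L T R) {T' : Finset ι} (hT' : T' ⊆ T) :
    GoodCutoffs L T' R :=
  ⟨h.1, h.2.imp fun _ hδ => ⟨hδ.1, fun j u hu => hδ.2 j u (hT' hu)⟩⟩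

lemma exists_goodCutoffs (hL : ∀ u ∈ T, 0 < L u) : ∃ R, GoodCutoffs L T R := by
  obtain ⟨δ, hδ, h⟩ :=
    exists_mem_Icc_forall_le_abs_sub_int (L := fun u => 2 * L u) (T := T) (ℓ := 1)
      (fun u hu => by have := hL u hu; positivity) one_pos
  choose R hR hRT using fun j : ℕ => h j
  refine ⟨R, tendsto_atTop_mono (fun j => (hR j).1) tendsto_natCast_atTop_atTop, 2 * δ,
    by positivity, fun j u hu => ?_⟩
  convert le_abs_sin_pi_mul (hRT j u hu) using 3
  ring

end Cutoffs

/-! ### Products of geometric series -/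

section GeomProd

variable {ι : Type*} {L : ι → ℝ} {T : Finset ι}

/-- The product `∏ u ∈ T, 1 / (1 - exp (-s L u))` of geometric series, the generating Dirichlet
series of the numbers `∑ u ∈ T, e u * L u` with `e u ∈ ℕ`. -/
noncomputable def geomProd (L : ι → ℝ) (T : Finset ι) (s : ℂ) : ℂ :=
  ∏ u ∈ T, (1 - exp (-(s * L u)))⁻¹

lemma mul_exp_le_norm_one_sub_exp {s : ℂ} {A δ : ℝ} (h : δ ≤ |Real.sin (s.im * A)|) :
    δ * Real.exp (-(s.re * A)) ≤ ‖1 - exp (-(s * A))‖ := by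
  have him : (1 - exp (-(s * A))).im = Real.exp (-(s.re * A)) * Real.sin (s.im * A) := by
    simp [exp_im]
  calc δ * Real.exp (-(s.re * A)) ≤ |(1 - exp (-(s * A))).im| := by
        rw [him, abs_mul, Real.abs_exp, mul_comm]
        gcongr
    _ ≤ ‖1 - exp (-(s * A))‖ := abs_im_le_norm _

lemma le_norm_one_sub_exp {s : ℂ} {A δ : ℝ} (h : δ ≤ |Real.sin (s.im * A)|) :
    δ ≤ ‖1 - exp (-(s * A))‖ := by
  have hneg := mul_exp_le_norm_one_sub_exp (s := -s) (A := A) (δ := δ) (by simpa using h)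
  have hreflect : 1 - exp (-(s * A)) = -(exp (-(s * A)) * (1 - exp (-(-s * A)))) := by
    rw [mul_sub, ← exp_add]
    simp
  calc δ = Real.exp (-(s.re * A)) * (δ * Real.exp (-((-s).re * A))) := by
        rw [mul_left_comm, ← Real.exp_add]
        simp
    _ ≤ Real.exp (-(s.re * A)) * ‖1 - exp (-(-s * A))‖ := by gcongr
    _ = ‖1 - exp (-(s * A))‖ := by
      rw [hreflect, norm_neg, norm_mul, norm_exp, neg_re, re_mul_ofReal]

lemma norm_geomProd_le {s : ℂ} {δ : ℝ} (hδ : 0 < δ) (h : ∀ v ∈ T, δ ≤ |Real.sin (s.im * L v)|)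
    {u : ι} (hu : u ∈ T) : ‖geomProd L T s‖ ≤ δ⁻¹ ^ T.card * Real.exp (L u * s.re) := by
  classical
  have hfactor : ‖(1 - exp (-(s * L u)))⁻¹‖ ≤ δ⁻¹ * Real.exp (L u * s.re) := by
    rw [norm_inv]
    refine (inv_anti₀ (by positivity) (mul_exp_le_norm_one_sub_exp (h u hu))).trans_eq ?_
    rw [mul_inv, ← Real.exp_neg, neg_neg, mul_comm (L u)]
  have hrest : ∏ v ∈ T.erase u, ‖(1 - exp (-(s * L v)))⁻¹‖ ≤ δ⁻¹ ^ (T.erase u).card := by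
    rw [← Finset.prod_const]
    refine Finset.prod_le_prod (fun _ _ => norm_nonneg _) fun v hv => ?_
    rw [norm_inv]
    exact inv_anti₀ hδ (le_norm_one_sub_exp (h v (Finset.mem_of_mem_erase hv)))
  rw [geomProd, norm_prod, ← Finset.mul_prod_erase _ _ hu]
  calc _ ≤ δ⁻¹ * Real.exp (L u * s.re) * δ⁻¹ ^ (T.erase u).card := by gcongr
    _ = _ := by
      rw [← Finset.card_erase_add_one hu, pow_succ]
      ring

lemma norm_geomProd_le_one {s : ℂ} (h : ∀ u ∈ T, 1 ≤ -(s.re * L u)) : ‖geomProd L T s‖ ≤ 1 := by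
  rw [geomProd, norm_prod]
  refine Finset.prod_le_one (fun _ _ => norm_nonneg _) fun u hu => ?_
  have hexp : 2 ≤ ‖exp (-(s * L u))‖ := by
    rw [norm_exp, neg_re, re_mul_ofReal]
    linarith [Real.add_one_le_exp (-(s.re * L u)), h u hu]
  rw [norm_inv, norm_sub_rev]
  refine inv_le_one_of_one_le₀ ?_
  have htri := norm_sub_norm_le (exp (-(s * L u))) 1
  rw [norm_one] at htri
  linarith

/-- The zeros `2πik / A` of `1 - exp (-s A)`. -/
noncomputable def pole (A : ℝ) (k : ℤ) : ℂ := 2 * π * k * I / A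

lemma pole_neg (A : ℝ) (k : ℤ) : pole A (-k) = (starRingEnd ℂ) (pole A k) := by
  simp [pole, conj_ofNat]

lemma pole_re (A : ℝ) (k : ℤ) : (pole A k).re = 0 := by simp [pole, div_ofReal_re]

lemma pole_im (A : ℝ) (k : ℤ) : (pole A k).im = 2 * π * k / A := by simp [pole, div_ofReal_im]

lemma pole_ne_zero {A : ℝ} (hA : A ≠ 0) {k : ℤ} (hk : k ≠ 0) : pole A k ≠ 0 := by
  simp [pole, hA, hk, Real.pi_ne_zero]

lemma exp_neg_mul_eq_one_iff {A : ℝ} (hA : A ≠ 0) {s : ℂ} :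
    exp (-(s * A)) = 1 ↔ ∃ k, s = pole A k := by
  have hA' : (A : ℂ) ≠ 0 := ofReal_ne_zero.2 hA
  rw [exp_eq_one_iff]
  constructor <;> rintro ⟨k, hk⟩ <;> refine ⟨-k, ?_⟩
  · rw [pole, eq_div_iff hA']
    push_cast
    linear_combination -hk
  · rw [hk, pole, div_mul_cancel₀ _ hA']
    push_cast
    ring

/-- Distinct members of the family `L u`, `u ∈ T`, have no common nonzero integer multiple. -/
def Incommensurable (L : ι → ℝ) (T : Finset ι) : Prop :=
  (T : Set ι).Pairwise fun u v => ∀ m n : ℤ, (m : ℝ) * L u = n * L v → m = 0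

lemma Incommensurable.eq_of_pole_eq (h : Incommensurable L T) (hL : ∀ u ∈ T, 0 < L u) {u v : ι}
    (hu : u ∈ T) (hv : v ∈ T) {k m : ℤ} (hk : k ≠ 0) (hkm : pole (L u) k = pole (L v) m) :
    u = v ∧ k = m := by
  have him := congrArg im hkm
  rw [pole_im, pole_im, div_eq_div_iff (hL u hu).ne' (hL v hv).ne'] at him
  have hmul : (k : ℝ) * L v = m * L u :=
    mul_left_cancel₀ Real.two_pi_pos.ne' (by linear_combination him)
  obtain rfl : u = v := by
    by_contra huv
    exact hk (h hv hu (Ne.symm huv) _ _ hmul)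
  exact ⟨rfl, by exact_mod_cast mul_right_cancel₀ (hL u hu).ne' hmul⟩

/-- The integrand `exp (s X) / s * ∏ u ∈ T, 1 / (1 - exp (-s L u))` of Perron's formula. -/
noncomputable def perronIntegrand (L : ι → ℝ) (T : Finset ι) (X : ℝ) (s : ℂ) : ℂ :=
  exp (s * X) * geomProd L T s / s

lemma differentiableAt_perronIntegrand (X : ℝ) {s : ℂ} (hs : s ≠ 0)
    (h : ∀ u ∈ T, exp (-(s * L u)) ≠ 1) : DifferentiableAt ℂ (perronIntegrand L T X) s := by
  refine DifferentiableAt.fun_div (DifferentiableAt.fun_mul (by fun_prop) ?_) differentiableAt_id hs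
  refine DifferentiableAt.fun_finsetProd fun u hu => ?_
  exact DifferentiableAt.fun_inv (by fun_prop) (sub_ne_zero.2 (h u hu).symm)

lemma tendsto_sub_pole_mul_inv_one_sub_exp {A : ℝ} (hA : A ≠ 0) (k : ℤ) :
    Tendsto (fun s => (s - pole A k) * (1 - exp (-(s * A)))⁻¹) (𝓝[≠] pole A k) (𝓝 (A : ℂ)⁻¹) := by
  have hexp : exp (-(pole A k * A)) = 1 := (exp_neg_mul_eq_one_iff hA).2 ⟨k, rfl⟩
  have hderiv : HasDerivAt (fun s => 1 - exp (-(s * A))) (A : ℂ) (pole A k) := by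
    refine (((hasDerivAt_id (pole A k)).mul_const (A : ℂ)).fun_neg.cexp.const_sub 1).congr_deriv ?_
    simp [hexp]
  refine ((hasDerivAt_iff_tendsto_slope.1 hderiv).inv₀ (ofReal_ne_zero.2 hA)).congr fun s => ?_
  rw [slope_def_field, hexp, sub_self, sub_zero, inv_div, div_eq_mul_inv]

lemma pole_mem_Ioo_reProdIm {A K R : ℝ} (hA : 0 < A) (hK : 0 < K)
    (hsin : Real.sin (2 * π * R * A) ≠ 0) {k : ℤ} (hk : |(k : ℝ)| ≤ R * A) :
    pole A k ∈ Set.Ioo (-K) 1 ×ℂ Set.Ioo (-(2 * π * R)) (2 * π * R) := by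
  have hne : |(k : ℝ)| ≠ R * A := fun heq => hsin <| by
    rw [show 2 * π * R * A = (2 * |k| : ℤ) * π by push_cast; rw [heq]; ring, Real.sin_int_mul_pi]
  obtain ⟨hlow, hupp⟩ := abs_lt.1 (hk.lt_of_ne hne)
  rw [mem_reProdIm, pole_re, pole_im]
  refine ⟨⟨by linarith, one_pos⟩, ?_, ?_⟩
  · rw [lt_div_iff₀ hA]
    linear_combination 2 * π * hlow
  · rw [div_lt_iff₀ hA]
    linear_combination 2 * π * hupp

lemma abs_le_of_pole_im_mem_Icc {A R : ℝ} (hA : 0 < A) {k : ℤ}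
    (h : (pole A k).im ∈ Set.Icc (-(2 * π * R)) (2 * π * R)) : |(k : ℝ)| ≤ R * A := by
  obtain ⟨hlow, hupp⟩ := h
  rw [pole_im, le_div_iff₀ hA] at hlow
  rw [pole_im, div_le_iff₀ hA] at hupp
  rw [abs_le]
  constructor <;> refine le_of_mul_le_mul_left ?_ Real.two_pi_pos <;> linarith

lemma sum_Icc_neg_erase_zero (g : ℤ → ℂ) (n : ℕ) :
    ∑ k ∈ (Finset.Icc (-(n : ℤ)) n).erase 0, g k = ∑ k ∈ Finset.Icc 1 n, (g k + g (-k)) := by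
  induction n with
  | zero => simp
  | succ n ih =>
    have hinsert : (Finset.Icc (-((n + 1 : ℕ) : ℤ)) (n + 1 : ℕ)).erase 0 =
        insert ((n + 1 : ℕ) : ℤ) (insert (-((n + 1 : ℕ) : ℤ))
          ((Finset.Icc (-(n : ℤ)) n).erase 0)) := by
      grind
    rw [Finset.sum_Icc_succ_top (by lia), ← ih, hinsert, Finset.sum_insert (by grind),
      Finset.sum_insert (by grind)]
    ring

/-- The indices `(u, k)` of the nonzero poles `pole (L u) k` of `perronIntegrand L T X` of height
at most `2π R`. -/
noncomputable def poleIndex (L : ι → ℝ) (T : Finset ι) (R : ℝ) : Finset (Σ _ : ι, ℤ) :=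
  T.sigma fun u => (Finset.Icc (-(⌊R * L u⌋₊ : ℤ)) ⌊R * L u⌋₊).erase 0

lemma mem_poleIndex (hL : ∀ u ∈ T, 0 < L u) {R : ℝ} (hR : 0 ≤ R) {u : ι} {k : ℤ} :
    (⟨u, k⟩ : Σ _ : ι, ℤ) ∈ poleIndex L T R ↔ u ∈ T ∧ k ≠ 0 ∧ |(k : ℝ)| ≤ R * L u := by
  rw [poleIndex, Finset.mem_sigma, Finset.mem_erase, Finset.mem_Icc]
  refine and_congr_right fun hu => and_congr_right fun _ => ?_
  rw [Int.natCast_floor_eq_floor (mul_nonneg hR (hL u hu).le), ← abs_le, ← Int.cast_abs,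
    Int.le_floor]

lemma norm_perronIntegrand_horizontal_le {X H δ : ℝ} (hX : 0 ≤ X) (hH : 0 < H) (hδ : 0 < δ)
    (hsin : ∀ v ∈ T, δ ≤ |Real.sin (H * L v)|) {u : ι} (hu : u ∈ T) {t σ : ℝ} (ht : |t| = H)
    (hσ : σ ≤ 1) : ‖perronIntegrand L T X (σ + t * I)‖ ≤
      Real.exp X * δ⁻¹ ^ T.card / H * Real.exp (L u * σ) := by
  have hgeom : ‖geomProd L T (σ + t * I)‖ ≤ δ⁻¹ ^ T.card * Real.exp (L u * σ) := by
    have hsin' : ∀ v ∈ T, δ ≤ |Real.sin ((σ + t * I : ℂ).im * L v)| := fun v hv => by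
      rcases (abs_eq hH.le).1 ht with rfl | rfl <;> simpa using hsin v hv
    simpa using norm_geomProd_le hδ hsin' hu
  have hexp : ‖exp ((σ + t * I) * X)‖ ≤ Real.exp X := by
    rw [norm_exp_mul_ofReal]
    simpa using mul_le_of_le_one_left hX hσ
  have hden : H ≤ ‖(σ + t * I : ℂ)‖ := by simpa [ht] using abs_im_le_norm (σ + t * I : ℂ)
  rw [perronIntegrand, norm_div, norm_mul]
  calc _ ≤ Real.exp X * (δ⁻¹ ^ T.card * Real.exp (L u * σ)) / H := by gcongr
    _ = _ := by ring

lemma eventually_norm_perronIntegrand_left_le (hL : ∀ u ∈ T, 0 < L u) (X : ℝ) :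
    ∀ᶠ K : ℝ in atTop, ∀ y : ℝ,
      ‖perronIntegrand L T X ((-K : ℝ) + y * I)‖ ≤ 1 * Real.exp (-K * X) / K := by
  have hlarge : ∀ᶠ K : ℝ in atTop, ∀ u ∈ T, 1 ≤ K * L u :=
    (Finset.eventually_all T).2 fun u hu =>
      (tendsto_id.atTop_mul_const (hL u hu)).eventually_ge_atTop 1
  filter_upwards [hlarge, eventually_gt_atTop 0] with K hK hK₀ y
  have hgeom : ‖geomProd L T ((-K : ℝ) + y * I)‖ ≤ 1 := norm_geomProd_le_one (by simpa using hK)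
  have hden : K ≤ ‖((-K : ℝ) + y * I : ℂ)‖ := by
    simpa [abs_of_pos hK₀] using abs_re_le_norm ((-K : ℝ) + y * I : ℂ)
  rw [perronIntegrand, norm_div, norm_mul, mul_comm, norm_exp_mul_ofReal]
  simp only [add_re, ofReal_re, mul_re, I_re, mul_zero, ofReal_im, I_im, sub_zero, add_zero,
    mul_one]
  gcongr

variable [DecidableEq ι]

/-- The residue of `perronIntegrand L T X` at `pole (L u) k`. -/
noncomputable def poleResidue (L : ι → ℝ) (T : Finset ι) (X : ℝ) (u : ι) (k : ℤ) : ℂ :=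
  exp (pole (L u) k * X) / (pole (L u) k * L u) *
    ∏ v ∈ T.erase u, (1 - exp (-(pole (L u) k * L v)))⁻¹

lemma poleResidue_neg (L : ι → ℝ) (T : Finset ι) (X : ℝ) (u : ι) (k : ℤ) :
    poleResidue L T X u (-k) = (starRingEnd ℂ) (poleResidue L T X u k) := by
  simp only [poleResidue, pole_neg, map_mul, map_div₀, map_prod, map_inv₀, map_sub, map_one,
    ← exp_conj, map_neg, conj_ofReal]

lemma hasResidueAt_perronIntegrand_pole (hL : ∀ u ∈ T, 0 < L u) (h : Incommensurable L T) (X : ℝ)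
    {u : ι} (hu : u ∈ T) {k : ℤ} (hk : k ≠ 0) :
    HasResidueAt (perronIntegrand L T X) (pole (L u) k) (poleResidue L T X u k) := by
  have hpole : pole (L u) k ≠ 0 := pole_ne_zero (hL u hu).ne' hk
  have hcont : ContinuousAt (fun s => exp (s * X) / s *
      ∏ v ∈ T.erase u, (1 - exp (-(s * L v)))⁻¹) (pole (L u) k) := by
    refine ContinuousAt.mul (by fun_prop (disch := assumption)) ?_
    refine tendsto_finsetProd _ fun v hv => ?_
    obtain ⟨hvu, hv⟩ := Finset.mem_erase.1 hv
    refine ContinuousAt.inv₀ (by fun_prop) (sub_ne_zero.2 fun hexp => ?_)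
    obtain ⟨m, hm⟩ := (exp_neg_mul_eq_one_iff (hL v hv).ne').1 hexp.symm
    exact hvu (h.eq_of_pole_eq hL hu hv hk hm).1.symm
  have hlim := (tendsto_sub_pole_mul_inv_one_sub_exp (hL u hu).ne' k).mul
    (hcont.tendsto.mono_left nhdsWithin_le_nhds)
  rw [← mul_assoc, inv_mul_eq_div, div_div] at hlim
  refine hasResidueAt_of_tendsto (hlim.congr fun s => ?_)
  rw [perronIntegrand, geomProd, ← Finset.mul_prod_erase _ _ hu]
  ring

lemma sum_poleIndex_poleResidue (L : ι → ℝ) (T : Finset ι) (X R : ℝ) :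
    ∑ i ∈ poleIndex L T R, poleResidue L T X i.1 i.2 =
      (∑ u ∈ T, ∑ k ∈ Finset.Icc 1 ⌊R * L u⌋₊, 2 * (poleResidue L T X u k).re : ℝ) := by
  simp only [poleIndex, Finset.sum_sigma, sum_Icc_neg_erase_zero, poleResidue_neg, add_conj,
    ofReal_sum]

lemma rectIntegral_perronIntegrand (hL : ∀ u ∈ T, 0 < L u) (h : Incommensurable L T) {X R K : ℝ}
    (hK : 0 < K) (hR : 0 < R) (hsin : ∀ u ∈ T, Real.sin (2 * π * R * L u) ≠ 0) {r : ℂ}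
    (hr : HasResidueAt (perronIntegrand L T X) 0 r) :
    rectIntegral (perronIntegrand L T X) (-K) 1 (-(2 * π * R)) (2 * π * R) = 2 * π * I *
      (r + ∑ i ∈ poleIndex L T R, poleResidue L T X i.1 i.2) := by
  have hT : 0 < 2 * π * R := mul_pos Real.two_pi_pos hR
  have hres := rectIntegral_eq_sum_residues (f := perronIntegrand L T X) (x₀ := -K) (x₁ := 1)
    (y₀ := -(2 * π * R)) (y₁ := 2 * π * R) (J := (poleIndex L T R).insertNone)
    (z := fun i => i.elim 0 fun i => pole (L i.1) i.2)
    (r := fun i => i.elim r fun i => poleResidue L T X i.1 i.2) (by linarith) (by linarith)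
    ?_ ?_ ?_ ?_
  · simpa only [Finset.sum_insertNone, Option.elim] using hres
  · rintro (_ | ⟨u, k⟩) hi (_ | ⟨v, m⟩) hj heq <;>
      simp only [Finset.mem_coe, Finset.some_mem_insertNone, mem_poleIndex hL hR.le] at hi hj
    · rfl
    · exact absurd heq.symm (pole_ne_zero (hL v hj.1).ne' hj.2.1)
    · exact absurd heq (pole_ne_zero (hL u hi.1).ne' hi.2.1)
    · obtain ⟨rfl, rfl⟩ := h.eq_of_pole_eq hL hi.1 hj.1 hi.2.1 heq
      rfl
  · rintro (_ | ⟨u, k⟩) hi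
    · simpa [mem_reProdIm] using ⟨hK, hT⟩
    · rw [Finset.some_mem_insertNone, mem_poleIndex hL hR.le] at hi
      exact pole_mem_Ioo_reProdIm (hL u hi.1) hK (hsin u hi.1) hi.2.2
  · intro s hs hs'
    have hs₀ : s ≠ 0 := fun h₀ => hs' ⟨none, by simp, h₀.symm⟩
    refine differentiableAt_perronIntegrand X hs₀ fun u hu hexp => ?_
    obtain ⟨k, rfl⟩ := (exp_neg_mul_eq_one_iff (hL u hu).ne').1 hexp
    refine hs' ⟨some ⟨u, k⟩, ?_, rfl⟩
    rw [Finset.mem_coe, Finset.some_mem_insertNone, mem_poleIndex hL hR.le]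
    refine ⟨hu, ?_, abs_le_of_pole_im_mem_Icc (hL u hu) (mem_reProdIm.1 hs).2⟩
    rintro rfl
    exact hs₀ (by simp [pole])
  · rintro (_ | ⟨u, k⟩) hi
    · exact hr
    · rw [Finset.some_mem_insertNone, mem_poleIndex hL hR.le] at hi
      exact hasResidueAt_perronIntegrand_pole hL h X hi.1 hi.2.1

lemma norm_integral_perronIntegrand_sub_le (hL : ∀ u ∈ T, 0 < L u) (h : Incommensurable L T)
    {X R δ : ℝ} (hX : 0 ≤ X) (hR : 0 < R) (hδ : 0 < δ)
    (hsin : ∀ u ∈ T, δ ≤ |Real.sin (2 * π * R * L u)|) {r : ℂ}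
    (hr : HasResidueAt (perronIntegrand L T X) 0 r) {u : ι} (hu : u ∈ T) :
    ‖(∫ y in (-(2 * π * R))..(2 * π * R), perronIntegrand L T X ((1 : ℝ) + y * I)) -
      2 * π * (r + ∑ i ∈ poleIndex L T R, poleResidue L T X i.1 i.2)‖ ≤
        2 * (Real.exp X * δ⁻¹ ^ T.card / (2 * π * R) * Real.exp (L u) / L u) := by
  have hH : 0 < 2 * π * R := mul_pos Real.two_pi_pos hR
  refine norm_integral_vertical_sub_le hH (hL u hu)
    (fun t ht σ hσ => norm_perronIntegrand_horizontal_le hX hH hδ hsin hu ht hσ)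
    ((eventually_norm_perronIntegrand_left_le hL X).mono fun K hK y _ => hK y)
    (tendsto_exp_neg_mul_div hX 1) ?_
  filter_upwards [eventually_gt_atTop 0] with K hK
  refine rectIntegral_perronIntegrand hL h hK hR (fun v hv hzero => ?_) hr
  have := hsin v hv
  rw [hzero, abs_zero] at this
  linarith

theorem tendsto_sum_poleResidue (hT : T.Nonempty) (hL : ∀ u ∈ T, 0 < L u)
    (h : Incommensurable L T) {R : ℕ → ℝ} (hR : GoodCutoffs L T R) {X : ℝ} (hX : 0 ≤ X)
    {κ : Type*} {lam : κ → ℝ} (hF : IsDirichletSum lam (geomProd L T)) {r : ℂ}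
    (hr : HasResidueAt (perronIntegrand L T X) 0 r) :
    Tendsto (fun j => ∑ u ∈ T, ∑ k ∈ Finset.Icc 1 ⌊R j * L u⌋₊, 2 * (poleResidue L T X u k).re)
      atTop (𝓝 (∑' i, perronStep (X - lam i) - r.re)) := by
  obtain ⟨u, hu⟩ := hT
  obtain ⟨hR, δ, hδ, hsin⟩ := hR
  have hheight : Tendsto (fun j => 2 * π * R j) atTop atTop :=
    hR.const_mul_atTop Real.two_pi_pos
  have hbound : Tendsto (fun j => 2 * (Real.exp X * δ⁻¹ ^ T.card / (2 * π * R j) *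
      Real.exp (L u) / L u)) atTop (𝓝 0) := by
    simpa [div_eq_mul_inv] using ((((tendsto_inv_atTop_zero.comp hheight).const_mul
      (Real.exp X * δ⁻¹ ^ T.card)).mul_const (Real.exp (L u))).div_const (L u)).const_mul 2
  have hdiff := squeeze_zero_norm' ((hR.eventually_gt_atTop 0).mono fun j hj =>
    norm_integral_perronIntegrand_sub_le hL h hX hj hδ (hsin j) hr hu) hbound
  have hlim := (((hF.tendsto_perron X).comp hheight).sub hdiff).const_mul (2 * π : ℂ)⁻¹
  rw [sub_zero, inv_mul_cancel_left₀ (by simp)] at hlim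
  have hre := ((continuous_re.tendsto _).comp hlim).sub_const r.re
  rw [ofReal_re] at hre
  refine hre.congr fun j => ?_
  simp only [Function.comp, sum_poleIndex_poleResidue, perronIntegrand, sub_sub_cancel]
  rw [inv_mul_cancel_left₀ (by simp), add_re, ofReal_re, add_sub_cancel_left]

end GeomProd

/-! ### Asymptotic expansions at a pole -/

section Expansion

open Asymptotics PowerSeries

/-- The formal power series `P` is an asymptotic expansion of `f` at the punctured point `0`. -/
def HasAsymptoticExpansion (f : ℂ → ℂ) (P : ℝ⟦X⟧) : Prop :=
  ∀ N : ℕ, (fun s : ℂ => f s - Polynomial.aeval s (P.trunc N)) =O[𝓝[≠] 0] fun s => s ^ N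

variable {f g : ℂ → ℂ} {P Q : ℝ⟦X⟧}

lemma isBigO_one_aeval (p : ℝ[X]) :
    (fun s : ℂ => Polynomial.aeval s p) =O[𝓝[≠] 0] fun _ => (1 : ℂ) :=
  ((p.continuous_aeval.tendsto 0).mono_left nhdsWithin_le_nhds).isBigO_one ℂ

lemma isBigO_pow_aeval {p : ℝ[X]} {N : ℕ} (h : ∀ i < N, p.coeff i = 0) :
    (fun s : ℂ => Polynomial.aeval s p) =O[𝓝[≠] 0] fun s => s ^ N := by
  obtain ⟨q, rfl⟩ := Polynomial.X_pow_dvd_iff.2 h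
  simpa using (isBigO_refl (fun s : ℂ => s ^ N) (𝓝[≠] 0)).mul (isBigO_one_aeval q)

lemma isBigO_aeval_trunc_mul_sub (P Q : ℝ⟦X⟧) (N : ℕ) :
    (fun s : ℂ => Polynomial.aeval s (P.trunc N) * Polynomial.aeval s (Q.trunc N) -
      Polynomial.aeval s ((P * Q).trunc N)) =O[𝓝[≠] 0] fun s => s ^ N := by
  simp only [← map_mul, ← map_sub]
  refine isBigO_pow_aeval fun i hi => ?_
  rw [Polynomial.coeff_sub, coeff_trunc, if_pos hi, coeff_mul_eq_coeff_trunc_mul_trunc P Q hi,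
    ← Polynomial.coe_mul, Polynomial.coeff_coe, sub_self]

lemma HasAsymptoticExpansion.congr' (hf : HasAsymptoticExpansion f P) (h : f =ᶠ[𝓝[≠] 0] g) :
    HasAsymptoticExpansion g P := fun N =>
  (hf N).congr' (h.mono fun s hs => by simp only [hs]) .rfl

lemma HasAsymptoticExpansion.isBigO_one (hf : HasAsymptoticExpansion f P) :
    f =O[𝓝[≠] 0] fun _ => (1 : ℂ) := by
  simpa using hf 0

lemma HasAsymptoticExpansion.tendsto (hf : HasAsymptoticExpansion f P) :
    Tendsto f (𝓝[≠] 0) (𝓝 (P.constantCoeff : ℝ)) := by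
  have hid : Tendsto (fun s : ℂ => s ^ 1) (𝓝[≠] 0) (𝓝 0) := by
    simp only [pow_one]
    exact nhdsWithin_le_nhds
  simpa [trunc_one_left] using ((hf 1).trans_tendsto hid).add_const ((P.constantCoeff : ℝ) : ℂ)

lemma HasAsymptoticExpansion.mul (hf : HasAsymptoticExpansion f P)
    (hg : HasAsymptoticExpansion g Q) :
    HasAsymptoticExpansion (fun s => f s * g s) (P * Q) := fun N => by
  have hleft := hf.isBigO_one.mul (hg N)
  have hright := (hf N).mul (isBigO_one_aeval (Q.trunc N))
  simp only [one_mul, mul_one] at hleft hright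
  refine ((hleft.add hright).add (isBigO_aeval_trunc_mul_sub P Q N)).congr_left fun s => ?_
  ring

lemma hasAsymptoticExpansion_one : HasAsymptoticExpansion (fun _ => 1) 1 := fun N => by
  refine (isBigO_pow_aeval (p := 1 - (1 : ℝ⟦X⟧).trunc N) (N := N) fun i hi => ?_).congr_left
    fun s => by simp
  simp [coeff_trunc, hi, Polynomial.coeff_one, coeff_one]

lemma HasAsymptoticExpansion.prod {ι : Type*} {f : ι → ℂ → ℂ} {P : ι → ℝ⟦X⟧} {T : Finset ι}
    (h : ∀ u ∈ T, HasAsymptoticExpansion (f u) (P u)) :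
    HasAsymptoticExpansion (fun s => ∏ u ∈ T, f u s) (∏ u ∈ T, P u) := by
  classical
  induction T using Finset.induction with
  | empty => simpa using hasAsymptoticExpansion_one
  | insert u T hu ih =>
    simp only [Finset.prod_insert hu]
    exact (h u (Finset.mem_insert_self u T)).mul
      (ih fun v hv => h v (Finset.mem_insert_of_mem hv))

lemma HasAsymptoticExpansion.one_sub (hf : HasAsymptoticExpansion f P) :
    HasAsymptoticExpansion (fun s => 1 - f s) (1 - P) := fun N =>
  ((hasAsymptoticExpansion_one N).sub (hf N)).congr_left fun s => by
    rw [map_sub, map_sub]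
    ring

lemma HasAsymptoticExpansion.inv (hf : HasAsymptoticExpansion f P) (h : P * Q = 1) :
    HasAsymptoticExpansion (fun s => (f s)⁻¹) Q := fun N => by
  have hP : ((P.constantCoeff : ℝ) : ℂ) ≠ 0 := by
    refine ofReal_ne_zero.2 fun h₀ => ?_
    simpa [h₀] using congrArg constantCoeff h
  have hone : (fun s : ℂ => 1 - f s * Polynomial.aeval s (Q.trunc N)) =O[𝓝[≠] 0]
      fun s => s ^ N := by
    have hprod := isBigO_aeval_trunc_mul_sub P Q N
    have herr := (hf N).mul (isBigO_one_aeval (Q.trunc N))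
    simp only [h, mul_one] at hprod herr
    refine (((hasAsymptoticExpansion_one N).sub hprod).sub herr).congr_left fun s => ?_
    ring
  refine ((((hf.tendsto.inv₀ hP).isBigO_one ℂ).mul hone).congr' ?_ ?_)
  · filter_upwards [hf.tendsto.eventually_ne hP] with s hs
    field_simp
  · simp

lemma HasAsymptoticExpansion.of_X_mul
    (h : HasAsymptoticExpansion (fun s => s * f s) (PowerSeries.X * P)) :
    HasAsymptoticExpansion f P := fun N => by
  have htrunc : (PowerSeries.X * P).trunc (N + 1) = Polynomial.X * P.trunc N := by
    ext i
    cases i <;> simp [coeff_trunc, Polynomial.coeff_X_mul, coeff_succ_X_mul]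
  have hdiv := (h (N + 1)).mul (isBigO_refl (fun s : ℂ => s⁻¹) (𝓝[≠] 0))
  refine hdiv.congr' ?_ ?_ <;> filter_upwards [self_mem_nhdsWithin] with s (hs : s ≠ 0)
  · rw [htrunc, map_mul, Polynomial.aeval_X]
    field_simp
  · rw [pow_succ, mul_inv_cancel_right₀ hs]

lemma HasAsymptoticExpansion.hasResidueAt_div_pow (hf : HasAsymptoticExpansion f P) (n : ℕ) :
    HasResidueAt (fun s => f s / s ^ (n + 1)) 0 (P.coeff n : ℝ) := by
  refine ⟨(P.trunc (n + 1)).map (algebraMap ℝ ℂ), n, by simp [coeff_trunc], ?_⟩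
  have hid : Tendsto (fun s : ℂ => s) (𝓝[≠] 0) (𝓝 0) := nhdsWithin_le_nhds
  refine (((hf (n + 1)).mul (isBigO_refl (fun s : ℂ => (s ^ n)⁻¹) (𝓝[≠] 0))).congr' ?_
    ?_).trans_tendsto hid <;> filter_upwards [self_mem_nhdsWithin] with s (hs : s ≠ 0)
  · rw [laurentPart, sub_zero, Polynomial.eval_map_algebraMap, pow_succ]
    field_simp
  · rw [pow_succ', mul_inv_cancel_right₀ (pow_ne_zero n hs)]

lemma hasAsymptoticExpansion_exp (c : ℝ) :
    HasAsymptoticExpansion (fun s => Complex.exp (s * c)) (rescale c (PowerSeries.exp ℝ)) :=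
  fun N => by
  have hid : Tendsto (fun s : ℂ => s * c) (𝓝[≠] 0) (𝓝 0) := by
    simpa using ((continuous_mul_const (c : ℂ)).tendsto 0).mono_left nhdsWithin_le_nhds
  refine (((exp_sub_sum_range_isBigO_pow N).comp_tendsto hid).trans ?_).congr_left fun s => ?_
  · simpa only [Function.comp_def, mul_pow, mul_comm] using
      isBigO_const_mul_self ((c : ℂ) ^ N) (fun s : ℂ => s ^ N) _
  · rw [Function.comp, trunc_apply, Nat.Ico_zero_eq_range, map_sum]
    congr 1
    refine Finset.sum_congr rfl fun i _ => ?_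
    simp [Polynomial.aeval_monomial, coeff_exp, coeff_rescale]
    ring

/-- The expansion of `s / (1 - exp (-s A))` at `0`, namely `∑ B⁺ᵢ Aⁱ⁻¹ sⁱ / i!`. -/
noncomputable def toddSeries (A : ℝ) : ℝ⟦X⟧ :=
  C A⁻¹ * rescale A (bernoulli'PowerSeries ℝ)

lemma coeff_toddSeries (A : ℝ) (i : ℕ) :
    (toddSeries A).coeff i = A⁻¹ * (A ^ i * (bernoulli' i / i.factorial)) := by
  simp [toddSeries, bernoulli'PowerSeries, coeff_rescale, coeff_C_mul]

lemma one_sub_exp_mul_toddSeries {A : ℝ} (hA : A ≠ 0) :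
    (1 - rescale (-A) (PowerSeries.exp ℝ)) * toddSeries A = PowerSeries.X := by
  have hexp : PowerSeries.exp ℝ * rescale (-1) (PowerSeries.exp ℝ) = 1 := exp_mul_exp_neg_eq_one
  have hone : (1 - rescale (-1) (PowerSeries.exp ℝ)) * bernoulli'PowerSeries ℝ =
      PowerSeries.X := by
    linear_combination rescale (-1) (PowerSeries.exp ℝ) *
      bernoulli'PowerSeries_mul_exp_sub_one ℝ + (PowerSeries.X - bernoulli'PowerSeries ℝ) * hexp
  have hscale := congrArg (rescale A) hone
  rw [map_mul, map_sub, map_one, rescale_rescale, rescale_X, mul_comm (-1), mul_neg_one] at hscale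
  rw [toddSeries, mul_left_comm, hscale, ← mul_assoc, ← map_mul, inv_mul_cancel₀ hA, map_one,
    one_mul]

lemma hasAsymptoticExpansion_todd {A : ℝ} (hA : A ≠ 0) :
    HasAsymptoticExpansion (fun s => s * (1 - Complex.exp (-(s * A)))⁻¹) (toddSeries A) := by
  obtain ⟨G, hG⟩ : PowerSeries.X ∣ 1 - rescale (-A) (PowerSeries.exp ℝ) := by
    rw [X_dvd_iff, ← coeff_zero_eq_constantCoeff_apply]
    simp [coeff_rescale, -coeff_zero_eq_constantCoeff]
  have hinv : G * toddSeries A = 1 := by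
    refine mul_left_cancel₀ (PowerSeries.X_ne_zero (R := ℝ)) ?_
    rw [← mul_assoc, ← hG, one_sub_exp_mul_toddSeries hA, mul_one]
  have hquot : HasAsymptoticExpansion (fun s => (1 - Complex.exp (-(s * A))) / s) G := by
    refine .of_X_mul ((hG ▸ (hasAsymptoticExpansion_exp (-A)).one_sub).congr' ?_)
    filter_upwards [self_mem_nhdsWithin] with s (hs : s ≠ 0)
    rw [mul_div_cancel₀ _ hs, ofReal_neg, mul_neg]
  exact (hquot.inv hinv).congr' (.of_forall fun s => by
    simp only [div_eq_mul_inv, mul_inv, inv_inv, mul_comm])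

variable {ι : Type*} {L : ι → ℝ} {T : Finset ι}

/-- The expansion of `exp (s X) * ∏ u ∈ T, s / (1 - exp (-s L u))` at `0`. -/
noncomputable def perronSeries (L : ι → ℝ) (T : Finset ι) (X : ℝ) : ℝ⟦X⟧ :=
  rescale X (PowerSeries.exp ℝ) * ∏ u ∈ T, toddSeries (L u)

lemma hasResidueAt_perronIntegrand_zero (hL : ∀ u ∈ T, 0 < L u) (X : ℝ) :
    HasResidueAt (perronIntegrand L T X) 0 ((perronSeries L T X).coeff T.card : ℝ) := by
  have hexp : HasAsymptoticExpansion
      (fun s => Complex.exp (s * X) * ∏ u ∈ T, s * (1 - Complex.exp (-(s * L u)))⁻¹)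
      (perronSeries L T X) :=
    (hasAsymptoticExpansion_exp X).mul
      (.prod fun u hu => hasAsymptoticExpansion_todd (hL u hu).ne')
  convert hexp.hasResidueAt_div_pow T.card using 1
  ext s
  rcases eq_or_ne s 0 with rfl | hs
  · simp [perronIntegrand]
  · rw [perronIntegrand, geomProd, Finset.prod_mul_distrib, Finset.prod_const]
    field_simp
    ring

end Expansion

/-! ### Cotangent sums -/

lemma isDirichletSum_geometric {A : ℝ} (hA : 0 < A) :
    IsDirichletSum (fun p : ℕ => p * A) fun s => (1 - exp (-(s * A)))⁻¹ := fun s hs => by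
  have hnorm : ‖exp (-(s * A))‖ < 1 := by
    rw [norm_exp, Real.exp_lt_one_iff]
    simpa using mul_pos hs hA
  simpa [← exp_nat_mul, mul_left_comm] using hasSum_geometric_of_norm_lt_one hnorm

lemma IsDirichletSum.mul {κ κ' : Type*} {lam : κ → ℝ} {mu : κ' → ℝ} {F G : ℂ → ℂ}
    (hF : IsDirichletSum lam F) (hG : IsDirichletSum mu G) :
    IsDirichletSum (fun i : κ × κ' => lam i.1 + mu i.2) fun s => F s * G s := fun s hs => by
  have hprod := summable_mul_of_summable_norm (hF s hs).summable.norm (hG s hs).summable.norm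
  refine ((hF s hs).mul (hG s hs) hprod).congr_fun fun i => ?_
  rw [← exp_add, ofReal_add, mul_add, neg_add]

section CotSums

variable {ι : Type*} {L : ι → ℝ} {T : Finset ι}

lemma exists_isDirichletSum_geomProd (hL : ∀ u ∈ T, 0 < L u) :
    ∃ (κ : Type) (lam : κ → ℝ), IsDirichletSum lam (geomProd L T) := by
  classical
  induction T using Finset.induction with
  | empty => exact ⟨Unit, fun _ => 0, fun s _ => by simp [geomProd]⟩
  | insert u T hu ih =>
    obtain ⟨κ, lam, hlam⟩ := ih fun v hv => hL v (Finset.mem_insert_of_mem hv)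
    have hgeom := isDirichletSum_geometric (hL u (Finset.mem_insert_self u T))
    refine ⟨ℕ × κ, fun i => i.1 * L u + lam i.2, fun s hs => ?_⟩
    simpa only [geomProd, Finset.prod_insert hu] using hgeom.mul hlam s hs

lemma sin_pi_mul_div_ne_zero (hL : ∀ u ∈ T, 0 < L u) (h : Incommensurable L T) {u v : ι}
    (hu : u ∈ T) (hv : v ∈ T) (huv : v ≠ u) {k : ℕ} (hk : k ≠ 0) :
    Real.sin (π * k * L v / L u) ≠ 0 := fun hsin => by
  obtain ⟨m, hm⟩ := Real.sin_eq_zero_iff.1 hsin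
  have hmul : ((k : ℤ) : ℝ) * L v = m * L u := by
    rw [eq_div_iff (hL u hu).ne'] at hm
    refine mul_left_cancel₀ Real.pi_ne_zero ?_
    push_cast
    linarith
  exact hk (by exact_mod_cast h hv hu huv _ _ hmul)

lemma inv_one_sub_exp {a : ℝ} (ha : Real.sin a ≠ 0) :
    (1 - exp (-(2 * a * I)))⁻¹ = (1 + -I * Real.cot a) / 2 := by
  have hsin : sin (a : ℂ) ≠ 0 := by exact_mod_cast ha
  have hexp : exp (-(2 * a * I)) = (cos a - sin a * I) ^ 2 := by
    rw [cos_sub_sin_I, ← exp_nat_mul]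
    congr 1
    push_cast
    ring
  refine inv_eq_of_mul_eq_one_right ?_
  rw [hexp, Real.cot_eq_cos_div_sin]
  push_cast
  field_simp
  linear_combination (2 * sin (a : ℂ) - (sin (a : ℂ) - I * cos a)) * sin_sq_add_cos_sq (a : ℂ) +
    (-2 * sin (a : ℂ) * cos a ^ 2 - sin (a : ℂ) ^ 2 * (sin (a : ℂ) - I * cos a)) * I_sq

lemma re_exp_div_I_mul_neg_I_pow (ψ : ℝ) (m : ℕ) :
    (exp (ψ * I) / I * (-I) ^ m).re = Real.sin (ψ - m * (π / 2)) := by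
  have hI : -I = exp (-(π / 2) * I) := by
    rw [neg_mul, exp_neg, exp_pi_div_two_mul_I, inv_I]
  rw [div_mul_eq_mul_div, hI, ← exp_nat_mul, ← exp_add, div_I, neg_re, mul_I_re, neg_neg]
  convert exp_ofReal_mul_I_im (ψ - m * (π / 2)) using 3
  push_cast
  ring

/-- The summand of index `k` of the cotangent series with base `u` and cotangent factors `S`. The
phase `#S * π / 2` makes the trigonometric factor `sin`, `-cos`, `-sin`, `cos` for
`#S = 0, 1, 2, 3`. -/
noncomputable def cotTerm (L : ι → ℝ) (X : ℝ) (u : ι) (S : Finset ι) (k : ℕ) : ℝ :=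
  Real.sin (2 * π * k * (X / L u) - S.card * (π / 2)) * (∏ v ∈ S, Real.cot (π * k * L v / L u)) / k

variable [DecidableEq ι]

lemma poleResidue_natCast (hL : ∀ u ∈ T, 0 < L u) (h : Incommensurable L T) (X : ℝ) {u : ι}
    (hu : u ∈ T) {k : ℕ} (hk : k ≠ 0) :
    poleResidue L T X u k = exp ((2 * π * k * (X / L u) : ℝ) * I) / (2 * π * k * I) *
      ∏ v ∈ T.erase u, (1 + -I * Real.cot (π * k * L v / L u)) / 2 := by
  have hLu : (L u : ℂ) ≠ 0 := ofReal_ne_zero.2 (hL u hu).ne'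
  rw [poleResidue]
  congr 1
  · simp only [pole]
    congr 1
    · congr 1
      push_cast
      ring
    · push_cast
      field_simp
  · refine Finset.prod_congr rfl fun v hv => ?_
    rw [← inv_one_sub_exp (sin_pi_mul_div_ne_zero hL h hu (Finset.mem_of_mem_erase hv)
      (Finset.ne_of_mem_erase hv) hk), pole]
    congr 3
    push_cast
    ring

lemma two_pow_mul_pi_mul_re_poleResidue (hL : ∀ u ∈ T, 0 < L u) (h : Incommensurable L T) (X : ℝ)
    {u : ι} (hu : u ∈ T) {k : ℕ} (hk : k ≠ 0) :
    2 ^ T.card * π * (poleResidue L T X u k).re =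
      ∑ S ∈ (T.erase u).powerset, cotTerm L X u S k := by
  have hexpand : (2 ^ T.card * π : ℝ) * poleResidue L T X u k =
      ∑ S ∈ (T.erase u).powerset, exp ((2 * π * k * (X / L u) : ℝ) * I) / I * (-I) ^ S.card *
        (((∏ v ∈ S, Real.cot (π * k * L v / L u)) / k : ℝ) : ℂ) := by
    have hk₀ : (k : ℂ) ≠ 0 := Nat.cast_ne_zero.2 hk
    have hπ : (π : ℂ) ≠ 0 := ofReal_ne_zero.2 Real.pi_ne_zero
    rw [poleResidue_natCast hL h X hu hk, Finset.prod_div_distrib, Finset.prod_const,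
      Finset.prod_one_add, ← Finset.card_erase_add_one hu, pow_succ, mul_div_assoc', mul_div_assoc',
      Finset.mul_sum, Finset.mul_sum, Finset.sum_div]
    refine Finset.sum_congr rfl fun S _ => ?_
    rw [Finset.prod_mul_distrib, Finset.prod_const]
    push_cast
    field_simp
  rw [← re_ofReal_mul, hexpand, re_sum]
  refine Finset.sum_congr rfl fun S _ => ?_
  rw [re_mul_ofReal, re_exp_div_I_mul_neg_I_pow, cotTerm, mul_div_assoc]

/-- The partial sum over `1 ≤ k ≤ ⌊R L_u⌋` of the cotangent series with base `u` and cotangent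
factors `S`. -/
noncomputable def cotSum (L : ι → ℝ) (X R : ℝ) (u : ι) (S : Finset ι) : ℝ :=
  ∑ k ∈ Finset.Icc 1 ⌊R * L u⌋₊, cotTerm L X u S k

/-- The partial sums of the cotangent series attached to the set `S`, summed over the choices of the
base in `S`. -/
noncomputable def symCotSum (L : ι → ℝ) (X R : ℝ) (S : Finset ι) : ℝ :=
  ∑ u ∈ S, cotSum L X R u (S.erase u)

lemma sum_sum_powerset_erase {M : Type*} [AddCommMonoid M] (T : Finset ι)
    (g : ι → Finset ι → M) :
    ∑ u ∈ T, ∑ S ∈ (T.erase u).powerset, g u S = ∑ S ∈ T.powerset, ∑ u ∈ S, g u (S.erase u) := by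
  rw [Finset.sum_sigma', Finset.sum_sigma']
  refine Finset.sum_bij' (fun p _ => ⟨insert p.1 p.2, p.1⟩) (fun q _ => ⟨q.2, q.1.erase q.2⟩)
    ?_ ?_ ?_ ?_ ?_ <;> rintro ⟨x, y⟩ hxy <;>
    simp only [Finset.mem_sigma, Finset.mem_powerset, Finset.subset_erase] at hxy ⊢
  · exact ⟨Finset.insert_subset hxy.1 hxy.2.1, Finset.mem_insert_self x y⟩
  · exact ⟨hxy.1 hxy.2, (Finset.erase_subset y x).trans hxy.1, Finset.notMem_erase y x⟩
  · rw [Finset.erase_insert hxy.2.2]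
  · rw [Finset.insert_erase hxy.2]
  · rw [Finset.erase_insert hxy.2.2]

lemma sum_symCotSum (hL : ∀ u ∈ T, 0 < L u) (h : Incommensurable L T) (X R : ℝ) :
    ∑ S ∈ T.powerset, symCotSum L X R S = 2 ^ T.card * π / 2 *
      ∑ u ∈ T, ∑ k ∈ Finset.Icc 1 ⌊R * L u⌋₊, 2 * (poleResidue L T X u k).re := by
  simp only [symCotSum]
  rw [← sum_sum_powerset_erase, Finset.mul_sum]
  refine Finset.sum_congr rfl fun u hu => ?_
  simp only [cotSum]
  rw [Finset.sum_comm, Finset.mul_sum]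
  refine Finset.sum_congr rfl fun k hk => ?_
  rw [← two_pow_mul_pi_mul_re_poleResidue hL h X hu
    (Nat.one_le_iff_ne_zero.1 (Finset.mem_Icc.1 hk).1)]
  ring

variable {R : ℕ → ℝ} {X : ℝ}

lemma tendsto_sum_symCotSum (hT : T.Nonempty) (hL : ∀ u ∈ T, 0 < L u) (h : Incommensurable L T)
    (hR : GoodCutoffs L T R) (hX : 0 ≤ X) {κ : Type*} {lam : κ → ℝ}
    (hF : IsDirichletSum lam (geomProd L T)) :
    Tendsto (fun j => ∑ S ∈ T.powerset, symCotSum L X (R j) S) atTop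
      (𝓝 (2 ^ T.card * π / 2 *
        (∑' i, perronStep (X - lam i) - (perronSeries L T X).coeff T.card))) := by
  simp only [sum_symCotSum hL h]
  simpa using (tendsto_sum_poleResidue hT hL h hR hX hF
    (hasResidueAt_perronIntegrand_zero hL X)).const_mul (2 ^ T.card * π / 2)

lemma exists_tendsto_symCotSum (hL : ∀ u ∈ T, 0 < L u) (h : Incommensurable L T)
    (hR : GoodCutoffs L T R) (hX : 0 ≤ X) :
    ∃ ℓ, Tendsto (fun j => symCotSum L X (R j) T) atTop (𝓝 ℓ) := by
  induction T using Finset.strongInduction with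
  | H T ih =>
    rcases T.eq_empty_or_nonempty with rfl | hT
    · exact ⟨0, by simp [symCotSum]⟩
    choose! ℓ hℓ using fun S (hS : S ∈ T.ssubsets) =>
      have hST := Finset.mem_ssubsets.1 hS
      ih S hST (fun u hu => hL u (hST.subset hu)) (h.mono hST.subset) (hR.mono hST.subset)
    obtain ⟨κ, lam, hF⟩ := exists_isDirichletSum_geomProd hL
    refine ⟨_, ((tendsto_sum_symCotSum hT hL h hR hX hF).sub (tendsto_finsetSum _ hℓ)).congr
      fun j => ?_⟩
    rw [← Finset.sum_erase_add _ _ (Finset.mem_powerset_self T), Finset.ssubsets,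
      add_sub_cancel_left]

end CotSums

/-! ### Counting -/

section Counting

variable {κ : Type*} {lam : κ → ℝ} {F : ℂ → ℂ}

lemma IsDirichletSum.finite_setOf_le (hF : IsDirichletSum lam F) (X : ℝ) :
    {i | lam i ≤ X}.Finite :=
  (finite_setOf_neg_one_lt (hF.summable_exp_sub X)).subset fun i (hi : lam i ≤ X) => by
    change -1 < X - lam i
    linarith

lemma IsDirichletSum.tsum_perronStep (hF : IsDirichletSum lam F) (X : ℝ) :
    ∑' i, perronStep (X - lam i) = {i | lam i ≤ X}.ncard - 1 / 2 * {i | lam i = X}.ncard := by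
  classical
  have hfin := hF.finite_setOf_le X
  have hsupp : ∀ i ∉ hfin.toFinset, perronStep (X - lam i) = 0 := fun i hi =>
    if_pos (by simpa using hi)
  have hval : ∀ i ∈ hfin.toFinset,
      perronStep (X - lam i) = 1 - 1 / 2 * if lam i = X then 1 else 0 := fun i hi => by
    have hle : lam i ≤ X := by simpa using hi
    rw [perronStep, if_neg (by linarith)]
    simp only [sub_eq_zero, eq_comm (a := X)]
    split_ifs <;> norm_num
  have heq : {i | lam i = X} = (hfin.toFinset.filter fun i => lam i = X) := by
    ext i
    simpa using le_of_eq
  rw [tsum_eq_sum hsupp, Finset.sum_congr rfl hval, Finset.sum_sub_distrib, ← Finset.mul_sum,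
    Finset.sum_boole, heq, Set.ncard_coe_finset, Set.ncard_eq_toFinset_card _ hfin]
  simp

lemma ncard_setOf_eq_of_injective {α β : Type*} {f : α → β} (hf : Function.Injective f) (y : β) :
    ({i | f i = y}.ncard : ℝ) = (Set.range f).indicator (fun _ => 1) y := by
  by_cases hy : y ∈ Set.range f
  · obtain ⟨i, rfl⟩ := hy
    simp [hf.eq_iff]
  · rw [Set.indicator_of_notMem hy, Set.eq_empty_of_forall_notMem (s := {i | f i = y})
      fun i hi => hy ⟨i, hi⟩]
    simp

lemma ncard_setOf_nat_mul_le {A X : ℝ} (hA : 0 < A) (hX : 0 ≤ X) :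
    {p : ℕ | p * A ≤ X}.ncard = ⌊X / A⌋₊ + 1 := by
  have hset : {p : ℕ | p * A ≤ X} = Finset.range (⌊X / A⌋₊ + 1) := by
    ext p
    simp [Nat.le_floor_iff (div_nonneg hX hA.le), le_div_iff₀ hA]
  rw [hset, Set.ncard_coe_finset, Finset.card_range]

lemma ncard_setOf_nat_mul_eq {A X : ℝ} (hA : 0 < A) (hX : 0 ≤ X) :
    ({p : ℕ | p * A = X}.ncard : ℝ) = if Int.fract (X / A) = 0 then 1 else 0 := by
  have hset : {p : ℕ | p * A = X} = {p : ℕ | (p : ℝ) = X / A} := by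
    simp only [eq_div_iff hA.ne']
  have hrange : X / A ∈ Set.range (Nat.cast : ℕ → ℝ) ↔ Int.fract (X / A) = 0 := by
    refine ⟨fun ⟨p, hp⟩ => hp ▸ Int.fract_natCast p, fun hfract => ⟨⌊X / A⌋₊, ?_⟩⟩
    rw [natCast_floor_eq_intCast_floor (div_nonneg hX hA.le), ← Int.self_sub_fract, hfract,
      sub_zero]
  classical
  rw [hset, ncard_setOf_eq_of_injective Nat.cast_injective, Set.indicator_apply]
  exact if_congr hrange rfl rfl

lemma tsum_perronStep_nat_mul {A X : ℝ} (hA : 0 < A) (hX : 0 ≤ X) :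
    ∑' p : ℕ, perronStep (X - p * A) = X / A + 1 / 2 - bernoulliOneStar (X / A) := by
  have hfloor : (⌊X / A⌋₊ : ℝ) = X / A - Int.fract (X / A) := by
    rw [natCast_floor_eq_intCast_floor (div_nonneg hX hA.le), Int.self_sub_fract]
  rw [(isDirichletSum_geometric hA).tsum_perronStep X, ncard_setOf_nat_mul_le hA hX,
    ncard_setOf_nat_mul_eq hA hX, bernoulliOneStar]
  push_cast
  rw [hfloor]
  split_ifs with h
  · rw [h]
    ring
  · ring

end Counting

@[to_additive]
lemma prod_quad {ι M : Type*} [DecidableEq ι] [CommMonoid M] {a b c d : ι}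
    (h : [a, b, c, d].Nodup) (f : ι → M) :
    ∏ u ∈ ({a, b, c, d} : Finset ι), f u = f a * (f b * (f c * f d)) := by
  simpa using List.prod_toFinset f h

section Coefficients

open Finset.Nat PowerSeries

lemma coeff_perronSeries_singleton {ι : Type*} {L : ι → ℝ} {u : ι} (hu : L u ≠ 0) (X : ℝ) :
    (perronSeries L {u} X).coeff 1 = X / L u + 1 / 2 := by
  simp only [perronSeries, Finset.prod_singleton, coeff_mul, sum_antidiagonal_eq_sum_range_succ_mk,
    Finset.sum_range_succ, Finset.sum_range_zero, coeff_toddSeries, coeff_rescale, coeff_exp,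
    Nat.factorial]
  norm_num
  field_simp
  ring

lemma coeff_perronSeries_four {ι : Type*} [DecidableEq ι] {a b c d : ι} (h : [a, b, c, d].Nodup)
    {L : ι → ℝ} (hL : ∀ u ∈ ({a, b, c, d} : Finset ι), L u ≠ 0) (X : ℝ) :
    (perronSeries L {a, b, c, d} X).coeff 4 = mainPoly (L a) (L b) (L c) (L d) X := by
  have ha := hL a (by simp)
  have hb := hL b (by simp)
  have hc := hL c (by simp)
  have hd := hL d (by simp)
  rw [perronSeries, prod_quad h, mainPoly]
  simp only [coeff_mul, sum_antidiagonal_eq_sum_range_succ_mk, Finset.sum_range_succ,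
    Finset.sum_range_zero, Nat.reduceSub, coeff_toddSeries, bernoulli'_zero,
    bernoulli'_one, bernoulli'_two, bernoulli'_three, bernoulli'_four, coeff_rescale, coeff_exp,
    Nat.factorial, eq_ratCast]
  push_cast
  field_simp
  ring

end Coefficients

/-! ### Multiplicative independence -/

section UniqueRep

/-- The logarithm of a natural number, as the family of frequencies to which the general results are
applied. -/
noncomputable abbrev logCast (n : ℕ) : ℝ :=
  Real.log n

lemma incommensurable_logCast {T : Finset ℕ} (hT : ∀ u ∈ T, 1 < u)
    (h : (T : Set ℕ).Pairwise fun u v => ∀ m n : ℕ, u ^ m = v ^ n → m = 0) :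
    Incommensurable logCast T := fun u hu v hv huv m n hmn => by
  have hlogu : 0 < logCast u := Real.log_pos (by exact_mod_cast hT u hu)
  have hlogv : 0 < logCast v := Real.log_pos (by exact_mod_cast hT v hv)
  have hpow : ∀ m n : ℤ, 0 ≤ m → m * logCast u = n * logCast v → m = 0 := fun m n hm hmn => by
    have hn : (0 : ℝ) ≤ n := nonneg_of_mul_nonneg_left (hmn ▸ by positivity) hlogv
    lift m to ℕ using hm
    lift n to ℕ using by exact_mod_cast hn
    push_cast at hmn
    rw [← Real.log_pow, ← Real.log_pow] at hmn
    have hu₀ : 0 < u := pos_of_gt (hT u hu)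
    have hv₀ : 0 < v := pos_of_gt (hT v hv)
    have heq := Real.log_injOn_pos (Set.mem_Ioi.2 (by positivity)) (Set.mem_Ioi.2 (by positivity))
      hmn
    exact_mod_cast h hu hv huv m n (by exact_mod_cast heq)
  rcases le_total 0 m with hm | hm
  · exact hpow m n hm hmn
  · exact neg_eq_zero.1 (hpow (-m) (-n) (neg_nonneg.2 hm) (by push_cast; linarith))

variable {a b c d : ℕ}

lemma UniqueRep.one_lt (h : UniqueRep a b c d) : ∀ u ∈ ({a, b, c, d} : Finset ℕ), 1 < u := by
  have hone : ∀ u : ℕ, u ^ 1 ≠ u ^ 2 → 1 < u := fun u hu => by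
    by_contra! hle
    interval_cases u <;> simp at hu
  simp only [Finset.forall_mem_insert, Finset.mem_singleton, forall_eq]
  refine ⟨hone a fun e => ?_, hone b fun e => ?_, hone c fun e => ?_, hone d fun e => ?_⟩
  · simpa using @h (1, 0, 0, 0) (2, 0, 0, 0) (by simpa using e)
  · simpa using @h (0, 1, 0, 0) (0, 2, 0, 0) (by simpa using e)
  · simpa using @h (0, 0, 1, 0) (0, 0, 2, 0) (by simpa using e)
  · simpa using @h (0, 0, 0, 1) (0, 0, 0, 2) (by simpa using e)

lemma UniqueRep.pairwise_pow_ne (h : UniqueRep a b c d) :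
    [a, b, c, d].Pairwise fun u v => ∀ m n : ℕ, u ^ m = v ^ n → m = 0 ∧ n = 0 := by
  simp only [List.pairwise_cons, List.forall_mem_cons, List.not_mem_nil, false_imp_iff,
    implies_true, and_true, List.Pairwise.nil]
  refine ⟨⟨fun m n e => ?_, fun m n e => ?_, fun m n e => ?_⟩,
    ⟨fun m n e => ?_, fun m n e => ?_⟩, fun m n e => ?_⟩
  · simpa [eq_comm] using @h (m, 0, 0, 0) (0, n, 0, 0) (by simpa using e)
  · simpa [eq_comm] using @h (m, 0, 0, 0) (0, 0, n, 0) (by simpa using e)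
  · simpa [eq_comm] using @h (m, 0, 0, 0) (0, 0, 0, n) (by simpa using e)
  · simpa [eq_comm] using @h (0, m, 0, 0) (0, 0, n, 0) (by simpa using e)
  · simpa [eq_comm] using @h (0, m, 0, 0) (0, 0, 0, n) (by simpa using e)
  · simpa [eq_comm] using @h (0, 0, m, 0) (0, 0, 0, n) (by simpa using e)

lemma UniqueRep.nodup (h : UniqueRep a b c d) : [a, b, c, d].Nodup :=
  h.pairwise_pow_ne.imp fun huv heq => by simpa using huv 1 1 (by rw [heq])

lemma UniqueRep.incommensurable (h : UniqueRep a b c d) :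
    Incommensurable logCast {a, b, c, d} := by
  refine incommensurable_logCast h.one_lt ?_
  have hsymm : Std.Symm fun u v : ℕ => ∀ m n : ℕ, u ^ m = v ^ n → m = 0 ∧ n = 0 :=
    ⟨fun u v huv m n e => (huv n m e.symm).symm⟩
  have hmem : (({a, b, c, d} : Finset ℕ) : Set ℕ) = {u | u ∈ [a, b, c, d]} := by
    ext u
    simp
  rw [hmem]
  exact h.pairwise_pow_ne.set_pairwise.mono' fun u v huv m n e => (huv m n e).1

lemma pow_mul_eq_pow_mul_iff {p q k m : ℕ} (ha : 1 < a) (hk : a.Coprime k) (hm : a.Coprime m) :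
    a ^ p * k = a ^ q * m ↔ p = q ∧ k = m := by
  refine ⟨fun h => ?_, fun ⟨hpq, hkm⟩ => by rw [hpq, hkm]⟩
  have hle : p ≤ q := (Nat.pow_dvd_pow_iff_le_right ha).1
    ((hm.pow_left p).dvd_of_dvd_mul_right ⟨k, h.symm⟩)
  have hge : q ≤ p := (Nat.pow_dvd_pow_iff_le_right ha).1
    ((hk.pow_left q).dvd_of_dvd_mul_right ⟨m, h⟩)
  obtain rfl := hle.antisymm hge
  exact ⟨rfl, Nat.eq_of_mul_eq_mul_left (pow_pos (pos_of_gt ha) p) h⟩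

lemma uniqueRep_of_pairwise_coprime (h : ∀ u ∈ [a, b, c, d], 1 < u)
    (hcop : [a, b, c, d].Pairwise Nat.Coprime) : UniqueRep a b c d := by
  rintro ⟨p, q, l, f⟩ ⟨p', q', l', f'⟩ heq
  simp only [List.pairwise_cons, List.forall_mem_cons, List.not_mem_nil, false_imp_iff,
    implies_true, and_true, List.Pairwise.nil] at h hcop
  obtain ⟨ha, hb, hc, hd⟩ := h
  obtain ⟨⟨hab, hac, had⟩, ⟨hbc, hbd⟩, hcd⟩ := hcop
  have ha' : ∀ q l f, a.Coprime (b ^ q * (c ^ l * d ^ f)) := fun q l f =>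
    (hab.pow_right q).mul_right ((hac.pow_right l).mul_right (had.pow_right f))
  have hb' : ∀ l f, b.Coprime (c ^ l * d ^ f) := fun l f =>
    (hbc.pow_right l).mul_right (hbd.pow_right f)
  simp only [mul_assoc] at heq
  rw [pow_mul_eq_pow_mul_iff ha (ha' ..) (ha' ..), pow_mul_eq_pow_mul_iff hb (hb' ..) (hb' ..),
    pow_mul_eq_pow_mul_iff hc (hcd.pow_right f) (hcd.pow_right f'), Nat.pow_right_inj hd] at heq
  simpa using heq

lemma uniqueRep_two_three_five_seven : UniqueRep 2 3 5 7 :=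
  uniqueRep_of_pairwise_coprime (by decide) (by decide)

end UniqueRep

/-! ### The cotangent formula -/

section CotFormula

lemma cotSum_singleton (x R : ℝ) (a b : ℕ) :
    cotSum logCast (Real.log x) R a {b} = -oneCot x R a b := by
  rw [cotSum, oneCot, ← Finset.sum_neg_distrib]
  refine Finset.sum_congr rfl fun k _ => ?_
  rw [cotTerm, Finset.prod_singleton, Finset.card_singleton, Nat.cast_one, one_mul,
    Real.sin_sub_pi_div_two, Real.cot_eq_cos_div_sin]
  ring

lemma cotSum_pair {b c : ℕ} (hbc : b ≠ c) (x R : ℝ) (a : ℕ) :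
    cotSum logCast (Real.log x) R a {b, c} = -twoCot x R a b c := by
  rw [cotSum, twoCot, ← Finset.sum_neg_distrib]
  refine Finset.sum_congr rfl fun k _ => ?_
  rw [cotTerm, Finset.prod_pair hbc, Finset.card_pair hbc, Nat.cast_two,
    mul_div_cancel₀ _ two_ne_zero, Real.sin_sub_pi, Real.cot_eq_cos_div_sin,
    Real.cot_eq_cos_div_sin]
  ring

lemma cotSum_triple {b c d : ℕ} (hbc : b ≠ c) (hbd : b ≠ d) (hcd : c ≠ d) (x R : ℝ) (a : ℕ) :
    cotSum logCast (Real.log x) R a {b, c, d} = threeCot x R a b c d := by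
  rw [cotSum, threeCot]
  refine Finset.sum_congr rfl fun k _ => ?_
  have hsin : ∀ ψ : ℝ, Real.sin (ψ - 3 * (π / 2)) = Real.cos ψ := fun ψ => by
    rw [← Real.sin_add_pi_div_two, ← Real.sin_sub_two_pi (ψ + π / 2)]
    congr 1
    ring
  rw [cotTerm, Finset.prod_insert (by simp [hbc, hbd]), Finset.prod_pair hcd,
    Finset.card_eq_three.2 ⟨b, c, d, hbc, hbd, hcd, rfl⟩, Nat.cast_ofNat, hsin]
  simp only [Real.cot_eq_cos_div_sin]
  ring

lemma symCotSum_pair {a b : ℕ} (hab : a ≠ b) (x R : ℝ) :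
    symCotSum logCast (Real.log x) R {a, b} = -(oneCot x R a b + oneCot x R b a) := by
  have ha : ({a, b} : Finset ℕ).erase a = {b} := by grind
  have hb : ({a, b} : Finset ℕ).erase b = {a} := by grind
  rw [symCotSum, Finset.sum_pair hab, ha, hb, cotSum_singleton, cotSum_singleton, neg_add]

lemma symCotSum_triple {a b c : ℕ} (hab : a ≠ b) (hac : a ≠ c) (hbc : b ≠ c) (x R : ℝ) :
    symCotSum logCast (Real.log x) R {a, b, c} =
      -(twoCot x R a b c + twoCot x R b a c + twoCot x R c a b) := by
  have ha : ({a, b, c} : Finset ℕ).erase a = {b, c} := by grind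
  have hb : ({a, b, c} : Finset ℕ).erase b = {a, c} := by grind
  have hc : ({a, b, c} : Finset ℕ).erase c = {a, b} := by grind
  rw [symCotSum, Finset.sum_insert (by simp [hab, hac]), Finset.sum_pair hbc, ha, hb, hc,
    cotSum_pair hbc, cotSum_pair hac, cotSum_pair hab]
  ring

lemma symCotSum_quad {a b c d : ℕ} (h : [a, b, c, d].Nodup) (x R : ℝ) :
    symCotSum logCast (Real.log x) R {a, b, c, d} = threeCot x R a b c d + threeCot x R b a c d +
      threeCot x R c a b d + threeCot x R d a b c := by
  have ha : ({a, b, c, d} : Finset ℕ).erase a = {b, c, d} := by grind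
  have hb : ({a, b, c, d} : Finset ℕ).erase b = {a, c, d} := by grind
  have hc : ({a, b, c, d} : Finset ℕ).erase c = {a, b, d} := by grind
  have hd : ({a, b, c, d} : Finset ℕ).erase d = {a, b, c} := by grind
  obtain ⟨⟨hab, hac, had⟩, ⟨hbc, hbd⟩, hcd⟩ :
      (a ≠ b ∧ a ≠ c ∧ a ≠ d) ∧ (b ≠ c ∧ b ≠ d) ∧ c ≠ d := by
    simpa using h
  rw [symCotSum, sum_quad h, ha, hb, hc, hd, cotSum_triple hbc hbd hcd, cotSum_triple hac had hcd,
    cotSum_triple hab had hbd, cotSum_triple hab hac hbc]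
  ring

lemma tendsto_symCotSum_singleton {ι : Type*} [DecidableEq ι] {L : ι → ℝ} {R : ℕ → ℝ} {X : ℝ}
    {u : ι} (hu : 0 < L u) (hR : GoodCutoffs L {u} R) (hX : 0 ≤ X) :
    Tendsto (fun j => symCotSum L X (R j) {u}) atTop
      (𝓝 (-(π * bernoulliOneStar (X / L u)))) := by
  have hF : IsDirichletSum (fun p : ℕ => p * L u) (geomProd L {u}) := fun s hs => by
    simpa only [geomProd, Finset.prod_singleton] using isDirichletSum_geometric hu s hs
  have hinc : Incommensurable L {u} := by simp [Incommensurable]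
  have hlim := tendsto_sum_symCotSum (Finset.singleton_nonempty u) (by simpa using hu) hinc hR hX hF
  rw [Finset.card_singleton, coeff_perronSeries_singleton hu.ne', tsum_perronStep_nat_mul hu hX]
    at hlim
  convert hlim using 2
  · rw [← insert_empty_eq, Finset.sum_powerset_insert (Finset.notMem_empty u)]
    simp [symCotSum]
  · ring

variable {a b c d : ℕ}

lemma isDirichletSum_log_monomial (h : [a, b, c, d].Nodup)
    (hone : ∀ u ∈ ({a, b, c, d} : Finset ℕ), 1 < u) :
    IsDirichletSum (fun e : ℕ × ℕ × ℕ × ℕ =>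
        Real.log ((a ^ e.1 * b ^ e.2.1 * c ^ e.2.2.1 * d ^ e.2.2.2 : ℕ) : ℝ))
      (geomProd logCast {a, b, c, d}) := by
  have hgeom : ∀ u ∈ ({a, b, c, d} : Finset ℕ), IsDirichletSum (fun p : ℕ => p * logCast u)
      fun s => (1 - exp (-(s * logCast u)))⁻¹ := fun u hu =>
    isDirichletSum_geometric (Real.log_pos (by exact_mod_cast hone u hu))
  have hprod := (hgeom a (by simp)).mul ((hgeom b (by simp)).mul
    ((hgeom c (by simp)).mul (hgeom d (by simp))))
  have hlog : (fun e : ℕ × ℕ × ℕ × ℕ =>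
      Real.log ((a ^ e.1 * b ^ e.2.1 * c ^ e.2.2.1 * d ^ e.2.2.2 : ℕ) : ℝ)) = fun e =>
        e.1 * logCast a + (e.2.1 * logCast b + (e.2.2.1 * logCast c + e.2.2.2 * logCast d)) := by
    have hne : ∀ u ∈ ({a, b, c, d} : Finset ℕ), ∀ n : ℕ, (u : ℝ) ^ n ≠ 0 := fun u hu n =>
      pow_ne_zero n (Nat.cast_ne_zero.2 (pos_of_gt (hone u hu)).ne')
    ext e
    have ha := hne a (by simp) e.1
    have hb := hne b (by simp) e.2.1
    have hc := hne c (by simp) e.2.2.1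
    have hd := hne d (by simp) e.2.2.2
    push_cast
    rw [mul_assoc, mul_assoc, Real.log_mul ha (by positivity), Real.log_mul hb (by positivity),
      Real.log_mul hc hd, Real.log_pow, Real.log_pow, Real.log_pow, Real.log_pow]
  rw [hlog]
  exact fun s hs => by simpa only [geomProd, prod_quad h] using hprod s hs

lemma UniqueRep.tsum_perronStep (h : UniqueRep a b c d) {x : ℝ} (hx : 0 < x) :
    ∑' e : ℕ × ℕ × ℕ × ℕ, perronStep (Real.log x -
        Real.log ((a ^ e.1 * b ^ e.2.1 * c ^ e.2.2.1 * d ^ e.2.2.2 : ℕ) : ℝ)) =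
      count a b c d x - 1 / 2 * chi a b c d x := by
  have hpos : ∀ e : ℕ × ℕ × ℕ × ℕ,
      (0 : ℝ) < (a ^ e.1 * b ^ e.2.1 * c ^ e.2.2.1 * d ^ e.2.2.2 : ℕ) := fun e => by
    have hu : ∀ u ∈ ({a, b, c, d} : Finset ℕ), 0 < u := fun u hu => pos_of_gt (h.one_lt u hu)
    simp only [Finset.forall_mem_insert, Finset.mem_singleton, forall_eq] at hu
    obtain ⟨ha, hb, hc, hd⟩ := hu
    positivity
  have hinj : Function.Injective fun e : ℕ × ℕ × ℕ × ℕ =>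
      ((a ^ e.1 * b ^ e.2.1 * c ^ e.2.2.1 * d ^ e.2.2.2 : ℕ) : ℝ) := Nat.cast_injective.comp h
  have hrange : smoothSet a b c d = Set.range fun e : ℕ × ℕ × ℕ × ℕ =>
      ((a ^ e.1 * b ^ e.2.1 * c ^ e.2.2.1 * d ^ e.2.2.2 : ℕ) : ℝ) := by
    ext y
    simp only [smoothSet, Set.mem_ofPred_eq, Set.mem_range, Prod.exists, eq_comm]
  rw [(isDirichletSum_log_monomial h.nodup h.one_lt).tsum_perronStep]
  simp only [Real.log_le_log_iff (hpos _) hx, Real.log_injOn_pos.eq_iff (hpos _) hx]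
  rw [ncard_setOf_eq_of_injective hinj, count, chi, hrange]

lemma sum_powerset_quad {ι M : Type*} [DecidableEq ι] [AddCommMonoid M] {a b c d : ι}
    (h : [a, b, c, d].Nodup) (f : Finset ι → M) :
    ∑ S ∈ ({a, b, c, d} : Finset ι).powerset, f S = f ∅ + (f {a} + f {b} + f {c} + f {d}) +
      (f {a, b} + f {a, c} + f {a, d} + f {b, c} + f {b, d} + f {c, d}) +
      (f {a, b, c} + f {a, b, d} + f {a, c, d} + f {b, c, d}) + f {a, b, c, d} := by
  obtain ⟨ha, hb, hc⟩ : a ∉ ({b, c, d} : Finset ι) ∧ b ∉ ({c, d} : Finset ι) ∧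
      c ∉ ({d} : Finset ι) := by
    simpa using h
  have hd (g : Finset ι → M) : ∑ S ∈ ({d} : Finset ι).powerset, g S = g ∅ + g {d} := by
    simpa using Finset.sum_powerset_insert (Finset.notMem_empty d) g
  simp only [Finset.sum_powerset_insert ha, Finset.sum_powerset_insert hb,
    Finset.sum_powerset_insert hc, hd, insert_empty_eq]
  abel

lemma UniqueRep.count_eq_of_tendsto_symCotSum (h : UniqueRep a b c d) {R : ℕ → ℝ}
    (hR : GoodCutoffs logCast {a, b, c, d} R) {x : ℝ} (hx : 1 ≤ x) {ℓ : Finset ℕ → ℝ}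
    (hℓ : ∀ S ⊆ ({a, b, c, d} : Finset ℕ),
      Tendsto (fun j => symCotSum logCast (Real.log x) (R j) S) atTop (𝓝 (ℓ S))) :
    (count a b c d x : ℝ) =
      mainPoly (logCast a) (logCast b) (logCast c) (logCast d) (Real.log x) -
      1 / 8 * (bernoulliOneStar (Real.log x / logCast a) +
        bernoulliOneStar (Real.log x / logCast b) + bernoulliOneStar (Real.log x / logCast c) +
        bernoulliOneStar (Real.log x / logCast d)) +
      1 / (8 * π) * ((ℓ {a, b} + ℓ {a, c} + ℓ {a, d} + ℓ {b, c} + ℓ {b, d} + ℓ {c, d}) +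
        (ℓ {a, b, c} + ℓ {a, b, d} + ℓ {a, c, d} + ℓ {b, c, d}) + ℓ {a, b, c, d}) +
      1 / 2 * chi a b c d x := by
  have hL : ∀ u ∈ ({a, b, c, d} : Finset ℕ), 0 < logCast u := fun u hu =>
    Real.log_pos (by exact_mod_cast h.one_lt u hu)
  have hX := Real.log_nonneg hx
  have hempty : ℓ ∅ = 0 :=
    tendsto_nhds_unique (hℓ ∅ (Finset.empty_subset _)) (by simp [symCotSum])
  have hsingle : ∀ u ∈ ({a, b, c, d} : Finset ℕ),
      ℓ {u} = -(π * bernoulliOneStar (Real.log x / logCast u)) := fun u hu =>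
    have hsub := Finset.singleton_subset_iff.2 hu
    tendsto_nhds_unique (hℓ {u} hsub) (tendsto_symCotSum_singleton (hL u hu) (hR.mono hsub) hX)
  have hcard : ({a, b, c, d} : Finset ℕ).card = 4 := by
    simpa using List.toFinset_card_of_nodup h.nodup
  have hsum := tendsto_nhds_unique (tendsto_finsetSum _ fun S hS => hℓ S (Finset.mem_powerset.1 hS))
    (tendsto_sum_symCotSum (by simp) hL h.incommensurable hR hX
      (isDirichletSum_log_monomial h.nodup h.one_lt))
  rw [sum_powerset_quad h.nodup, hempty, hsingle a (by simp), hsingle b (by simp),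
    hsingle c (by simp), hsingle d (by simp), h.tsum_perronStep (by linarith), hcard,
    coeff_perronSeries_four h.nodup fun u hu => (hL u hu).ne'] at hsum
  field_simp
  linarith

lemma UniqueRep.cotFormula (h : UniqueRep a b c d) {R : ℕ → ℝ}
    (hR : GoodCutoffs logCast {a, b, c, d} R) {x : ℝ} (hx : 1 ≤ x) : CotFormula a b c d R x := by
  have hL : ∀ u ∈ ({a, b, c, d} : Finset ℕ), 0 < logCast u := fun u hu =>
    Real.log_pos (by exact_mod_cast h.one_lt u hu)
  obtain ⟨⟨hab, hac, had⟩, ⟨hbc, hbd⟩, hcd⟩ :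
      (a ≠ b ∧ a ≠ c ∧ a ≠ d) ∧ (b ≠ c ∧ b ≠ d) ∧ c ≠ d := by
    simpa using h.nodup
  choose! ℓ hℓ using fun S (hS : S ⊆ ({a, b, c, d} : Finset ℕ)) =>
    exists_tendsto_symCotSum (fun u hu => hL u (hS hu)) (h.incommensurable.mono hS) (hR.mono hS)
      (Real.log_nonneg hx)
  have hpair : ∀ u v, u ≠ v → {u, v} ⊆ ({a, b, c, d} : Finset ℕ) →
      HasPairSum R x u v (-ℓ {u, v}) := fun u v huv hS => by
    simpa only [HasPairSum, symCotSum_pair huv, neg_neg] using (hℓ _ hS).neg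
  have htriple : ∀ u v w, u ≠ v → u ≠ w → v ≠ w → {u, v, w} ⊆ ({a, b, c, d} : Finset ℕ) →
      HasTripleSum R x u v w (-ℓ {u, v, w}) := fun u v w huv huw hvw hS => by
    simpa only [HasTripleSum, symCotSum_triple huv huw hvw, neg_neg] using (hℓ _ hS).neg
  have hquad : HasQuadSum R x a b c d (ℓ {a, b, c, d}) := by
    simpa only [HasQuadSum, symCotSum_quad h.nodup] using hℓ _ Finset.Subset.rfl
  refine ⟨_, _, _, _, _, _, _, _, _, _, _, hpair a b hab (by grind), hpair a c hac (by grind),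
    hpair a d had (by grind), hpair b c hbc (by grind), hpair b d hbd (by grind),
    hpair c d hcd (by grind), htriple a b c hab hac hbc (by grind),
    htriple a b d hab had hbd (by grind), htriple a c d hac had hcd (by grind),
    htriple b c d hbc hbd hcd (by grind), hquad, ?_⟩
  rw [h.count_eq_of_tendsto_symCotSum hR hx hℓ]
  ring

end CotFormula

end SmoothCount

theorem corollary16_general {a b c d : ℕ} (h : SmoothCount.UniqueRep a b c d) :
    ∃ R : ℕ → ℝ, Tendsto R atTop atTop ∧
      ∀ x : ℝ, 1 ≤ x → SmoothCount.CotFormula a b c d R x := by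
  obtain ⟨R, hR⟩ := SmoothCount.exists_goodCutoffs (L := SmoothCount.logCast) fun u hu =>
    Real.log_pos (by exact_mod_cast h.one_lt u hu)
  exact ⟨R, hR.1, fun x hx => h.cotFormula hR hx⟩

theorem corollary16 :
    (∀ a b c d : ℕ, a < b → b < c → c < d →
      Nat.gcd a (Nat.gcd b (Nat.gcd c d)) = 1 →
      SmoothCount.UniqueRep a b c d →
      ∃ R : ℕ → ℝ, Tendsto R atTop atTop ∧
        ∀ x : ℝ, 1 ≤ x → SmoothCount.CotFormula a b c d R x) ∧
    (∃ R : ℕ → ℝ, Tendsto R atTop atTop ∧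
        ∀ x : ℝ, 1 ≤ x → SmoothCount.CotFormula 2 3 5 7 R x) :=
  ⟨fun _ _ _ _ _ _ _ _ h => corollary16_general h,
    corollary16_general SmoothCount.uniqueRep_two_three_five_seven⟩
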